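/- Throughout, a graph is a simple undirected graph (no loops, no multiple edges; possibly infinite, empty or disconnected). A graph map sends vertices to vertices and maps every edge to an edge or to a vertex. For $n\ge 0$ let $I^n$ be the graph with vertex set $\{0,1\}^n$ in which two vertices are adjacent when they differ in exactly one coordinate. For a graph $G$, a singular $n$-cube is a graph map $\sigma\colon I^n\to G$, and $Q_n(G)$ is the free abelian group on the singular $n$-cubes. Let $f_i^-\sigma$ and $f_i^+\sigma$ be the singular $(n-1)$-cubes obtained from $\sigma$ by fixing the $i$-th coordinate equal to $0$ and to $1$ respectively, and let $\partial_n\sigma=\sum_{i=1}^n(-1)^i(f_i^-\sigma-f_i^+\sigma)$. A singular $n$-cube $\sigma$ is degenerate if $f_i^-\sigma=f_i^+\sigma$ for some $i$; the degenerate cubes span a subcomplex $D_*(G)\subseteq Q_*(G)$, and $C_*(G):=Q_*(G)/D_*(G)$. The degree of a singular $n$-cube $\sigma$ is the largest dimension of a face of $I^n$ (of any dimension $0,\dots,n$) on which $\sigma$ is injective. For an integer $k$ let $C_n^k(G)\subseteq C_n(G)$ be the subgroup generated by the singular $n$-cubes of degree at most $k$. These form subcomplexes $C_*^k(G)$ of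 $C_*(G)$. Put $C_*^{[k]}(G):=C_*^k(G)/C_*^{k-1}(G)$ and $H_n^{[k]}(G):=H_n(C_*^{[k]}(G))$. **Theorem.** Let $G$ be a triangle-free graph. Then $H_n^{[1]}(G)=0$ for every $n\ge 2$. -/

import Mathlib

open CategoryTheory

universe u

namespace DiscreteCubical

/-- The discrete `n`-cube graph `I^n`: vertices are `{0,1}^n` (with `false = 0`, `true = 1`), and two
vertices are adjacent when they differ in exactly one coordinate. -/
def cube (n : ℕ) : SimpleGraph (Fin n → Bool) where
  Adj x y := ∃! i, x i ≠ y i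
  symm := ⟨fun x y h => by simpa only [ne_comm] using h⟩
  loopless := ⟨fun x h => by obtain ⟨i, hi, -⟩ := h; exact hi rfl⟩

/-- A graph map: a map of vertex sets which sends every edge to an edge or to a vertex. -/
@[ext]
structure GraphMap {V W : Type*} (G : SimpleGraph V) (H : SimpleGraph W) where
  toFun : V → W
  map_adj' : ∀ v w, G.Adj v w → toFun v = toFun w ∨ H.Adj (toFun v) (toFun w)

variable {V : Type u} (G : SimpleGraph V)

/-- A singular `n`-cube of `G`: a graph map `I^n → G`. -/
abbrev SingularCube (n : ℕ) : Type u := GraphMap (cube n) G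

variable {G}

/-- The face of a singular `(n+1)`-cube obtained by fixing the `i`-th coordinate equal to `b`:
the front face `f_i^-` for `b = false` and the back face `f_i^+` for `b = true`. -/
def SingularCube.face {n : ℕ} (i : Fin (n + 1)) (b : Bool) (σ : SingularCube G (n + 1)) :
    SingularCube G n where
  toFun x := σ.toFun (i.insertNth b x)
  map_adj' x y h := by
    apply σ.map_adj'
    obtain ⟨k, hk, hu⟩ := h
    refine ⟨i.succAbove k, by simpa using hk, fun m hm => ?_⟩
    rcases Fin.eq_self_or_eq_succAbove i m with rfl | ⟨l, rfl⟩
    · simp at hm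
    · rw [hu l (by simpa using hm)]

/-- A singular `n`-cube is degenerate if for some coordinate `i` its front and back `i`-faces
coincide. -/
def SingularCube.IsDegenerate {n : ℕ} (σ : SingularCube G n) : Prop :=
  ∃ i : Fin n, ∀ x : Fin n → Bool,
    σ.toFun (Function.update x i false) = σ.toFun (Function.update x i true)

theorem SingularCube.face_eq_face_iff {n : ℕ} (σ : SingularCube G (n + 1)) (i : Fin (n + 1)) :
    σ.face i false = σ.face i true ↔
      ∀ x, σ.toFun (Function.update x i false) = σ.toFun (Function.update x i true) := by
  constructor
  · intro h x
    have := congrFun (congrArg GraphMap.toFun h) (i.removeNth x)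
    simpa [SingularCube.face, Fin.insertNth_removeNth] using this
  · intro h
    ext x
    simpa [SingularCube.face, Fin.update_insertNth] using h (i.insertNth false x)

theorem SingularCube.isDegenerate_iff {n : ℕ} (σ : SingularCube G (n + 1)) :
    σ.IsDegenerate ↔ ∃ i, σ.face i false = σ.face i true := by
  simp only [SingularCube.IsDegenerate, SingularCube.face_eq_face_iff]

/-- The face of the cube `I^n` through the vertex `a` with set of free coordinates `S`; it is a
cube of dimension `S.card`. -/
def cubeFace {n : ℕ} (S : Finset (Fin n)) (a : Fin n → Bool) : Set (Fin n → Bool) :=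
  {x | ∀ i, i ∉ S → x i = a i}

/-- The degree of a singular `n`-cube `σ`: the largest dimension of a face of the cube `I^n` (of any
dimension) on which `σ` is injective. The set is nonempty (vertices) and bounded by `n`. -/
noncomputable def SingularCube.degree {n : ℕ} (σ : SingularCube G n) : ℕ :=
  sSup {k | ∃ (S : Finset (Fin n)) (a : Fin n → Bool),
    S.card = k ∧ Set.InjOn σ.toFun (cubeFace S a)}

theorem SingularCube.degree_le_iff {n : ℕ} (σ : SingularCube G n) (k : ℕ) :
    σ.degree ≤ k ↔ ∀ (S : Finset (Fin n)) (a : Fin n → Bool),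
      Set.InjOn σ.toFun (cubeFace S a) → S.card ≤ k := by
  have hne : {k | ∃ (S : Finset (Fin n)) (a : Fin n → Bool),
      S.card = k ∧ Set.InjOn σ.toFun (cubeFace S a)}.Nonempty := by
    refine ⟨0, ∅, fun _ => false, by simp, fun x hx y hy _ => funext fun i => ?_⟩
    rw [hx i (by simp), hy i (by simp)]
  have hbdd : BddAbove {k | ∃ (S : Finset (Fin n)) (a : Fin n → Bool),
      S.card = k ∧ Set.InjOn σ.toFun (cubeFace S a)} := by
    refine ⟨n, ?_⟩
    rintro _ ⟨S, a, rfl, -⟩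
    simpa using S.card_le_univ
  rw [SingularCube.degree, csSup_le_iff hbdd hne]
  constructor
  · exact fun h S a hS => h _ ⟨S, a, rfl, hS⟩
  · rintro h _ ⟨S, a, rfl, hS⟩
    exact h S a hS

theorem SingularCube.degree_face_le {n : ℕ} (σ : SingularCube G (n + 1)) (i : Fin (n + 1))
    (b : Bool) : (σ.face i b).degree ≤ σ.degree := by
  rw [SingularCube.degree_le_iff]
  intro S a hS
  rw [← Finset.card_map i.succAboveEmb (s := S)]
  refine (σ.degree_le_iff _).1 le_rfl _ (i.insertNth b a) ?_
  have key : ∀ x ∈ cubeFace (S.map i.succAboveEmb) (i.insertNth b a),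
      x i = b ∧ i.removeNth x ∈ cubeFace S a := by
    intro x hx
    refine ⟨?_, fun k hk => ?_⟩
    · have := hx i (by simp [Fin.succAbove_ne])
      simpa using this
    · have := hx (i.succAbove k) (by simpa using hk)
      simpa [Fin.removeNth] using this
  intro x hx y hy hxy
  obtain ⟨hx1, hx2⟩ := key x hx
  obtain ⟨hy1, hy2⟩ := key y hy
  have hx3 : i.insertNth b (i.removeNth x) = x := by rw [← hx1]; simp
  have hy3 : i.insertNth b (i.removeNth y) = y := by rw [← hy1]; simp
  have := hS hx2 hy2 (by simpa only [SingularCube.face, hx3, hy3] using hxy)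
  rw [← hx3, ← hy3, this]

theorem SingularCube.face_face {n : ℕ} (σ : SingularCube G (n + 2)) (i j : Fin (n + 1))
    (h : i ≤ j) (a b : Bool) :
    (σ.face j.succ b).face i a = (σ.face i.castSucc a).face j b := by
  ext x
  simp only [SingularCube.face]
  congr 1
  rw [Fin.eq_insertNth_iff]
  have h1 : j.succ.succAbove i = i.castSucc := by
    rw [Fin.succAbove_of_castSucc_lt]
    exact Fin.lt_def.2 (by have := Fin.le_def.1 h; simp; omega)
  refine ⟨?_, ?_⟩
  · rw [← h1, Fin.insertNth_apply_succAbove, Fin.insertNth_apply_same]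
  · rw [Fin.eq_insertNth_iff]
    have h2 : i.castSucc.succAbove j = j.succ := by
      rw [Fin.succAbove_of_le_castSucc]
      exact Fin.le_def.2 (by have := Fin.le_def.1 h; simpa)
    refine ⟨by simp only [Fin.removeNth, h2, Fin.insertNth_apply_same], funext fun k => ?_⟩
    have h3 : i.castSucc.succAbove (j.succAbove k) = j.succ.succAbove (i.succAbove k) := by
      have := Fin.le_def.1 h
      ext
      simp only [Fin.succAbove, Fin.lt_def]
      split_ifs <;> simp_all <;> omega
    simp only [Fin.removeNth, h3, Fin.insertNth_apply_succAbove]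

variable (G)

/-- The free abelian group `Q_n(G)` on the singular `n`-cubes of `G`. -/
abbrev FreeChains (n : ℕ) : Type u := SingularCube G n →₀ ℤ

/-- The difference `f_i^- - f_i^+` of the front and back `i`-face operators. -/
noncomputable def faceDiff (n : ℕ) (i : Fin (n + 1)) :
    FreeChains G (n + 1) →ₗ[ℤ] FreeChains G n :=
  Finsupp.lmapDomain ℤ ℤ (SingularCube.face i false) -
    Finsupp.lmapDomain ℤ ℤ (SingularCube.face i true)

/-- The boundary operator on `Q_*(G)`. The index `i : Fin (n + 1)` stands for the `(i+1)`-st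
coordinate, hence the sign `(-1)^(i+1)`. -/
noncomputable def boundaryQ (n : ℕ) : FreeChains G (n + 1) →ₗ[ℤ] FreeChains G n :=
  ∑ i : Fin (n + 1), (-1 : ℤ) ^ ((i : ℕ) + 1) • faceDiff G n i

theorem faceDiff_single (n : ℕ) (i : Fin (n + 1)) (σ : SingularCube G (n + 1)) :
    faceDiff G n i (Finsupp.single σ 1) =
      Finsupp.single (σ.face i false) 1 - Finsupp.single (σ.face i true) 1 := by
  simp [faceDiff]

theorem boundaryQ_single (n : ℕ) (σ : SingularCube G (n + 1)) :
    boundaryQ G n (Finsupp.single σ 1) = ∑ i : Fin (n + 1), (-1 : ℤ) ^ ((i : ℕ) + 1) •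
      (Finsupp.single (σ.face i false) 1 - Finsupp.single (σ.face i true) 1) := by
  simp [boundaryQ, faceDiff_single]

theorem faceDiff_faceDiff (n : ℕ) (i j : Fin (n + 1)) (h : i ≤ j) :
    faceDiff G n i ∘ₗ faceDiff G (n + 1) j.succ =
      faceDiff G n j ∘ₗ faceDiff G (n + 1) i.castSucc := by
  refine Finsupp.lhom_ext' fun σ => LinearMap.ext_ring ?_
  simp only [LinearMap.comp_apply, Finsupp.lsingle_apply, faceDiff_single, map_sub,
    SingularCube.face_face σ i j h]
  abel

theorem boundaryQ_comp (n : ℕ) : boundaryQ G n ∘ₗ boundaryQ G (n + 1) = 0 := by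
  have expand : boundaryQ G n ∘ₗ boundaryQ G (n + 1) =
      ∑ ij : Fin (n + 1) × Fin (n + 2), ((-1 : ℤ) ^ ((ij.1 : ℕ) + 1) * (-1) ^ ((ij.2 : ℕ) + 1)) •
        (faceDiff G n ij.1 ∘ₗ faceDiff G (n + 1) ij.2) := by
    refine LinearMap.ext fun c => ?_
    simp only [boundaryQ, LinearMap.comp_apply, LinearMap.sum_apply, LinearMap.smul_apply, map_sum,
      map_smul, Finset.smul_sum, smul_smul, Fintype.sum_prod_type]
    rw [Finset.sum_comm]
    simp only [mul_comm]
  rw [expand]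
  let P := Fin (n + 1) × Fin (n + 2)
  let S : Finset P := {ij : P | (ij.2 : ℕ) ≤ (ij.1 : ℕ)}
  rw [← Finset.sum_add_sum_compl S, ← eq_neg_iff_add_eq_zero,
    ← Finset.sum_neg_distrib]
  let φ : ∀ ij : P, ij ∈ S → P := fun ij hij =>
    (Fin.castLT ij.2 (lt_of_le_of_lt (Finset.mem_filter.mp hij).right (Fin.is_lt ij.1)), ij.1.succ)
  apply Finset.sum_bij φ
  · intro ij hij
    simp_rw [S, φ, Finset.compl_filter, Finset.mem_filter_univ, Fin.val_succ,
      Fin.val_castLT] at hij ⊢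
    lia
  · rintro ⟨i, j⟩ hij ⟨i', j'⟩ hij' h
    rw [Prod.mk_inj]
    exact ⟨by simpa [φ] using! congr_arg Prod.snd h,
      by simpa [φ, Fin.castSucc_castLT] using! congr_arg Fin.castSucc (congr_arg Prod.fst h)⟩
  · rintro ⟨i', j'⟩ hij'
    simp_rw [S, Finset.compl_filter, Finset.mem_filter_univ, not_le] at hij'
    refine ⟨(j'.pred <| ?_, Fin.castSucc i'), ?_, ?_⟩
    · rintro rfl
      simp only [Fin.val_zero, not_lt_zero] at hij'
    · simpa [S] using! Nat.le_sub_one_of_lt hij'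
    · simp only [φ, Fin.castLT_castSucc, Fin.succ_pred]
  · rintro ⟨i, j⟩ hij
    have hij' : (j : ℕ) ≤ i := (Finset.mem_filter.mp hij).right
    obtain ⟨j, rfl⟩ : ∃ j' : Fin (n + 1), j = j'.castSucc :=
      ⟨j.castLT (lt_of_le_of_lt hij' i.is_lt), by simp⟩
    have hji : j ≤ i := Fin.le_def.2 (by simpa using hij')
    simp only [φ, Fin.castLT_castSucc,
      faceDiff_faceDiff G n j i hji, ← neg_smul]
    congr 1
    simp only [Fin.val_succ, Fin.val_castSucc, pow_add, pow_one]
    ring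

/-- The subgroup `D_n(G)` of `Q_n(G)` spanned by the degenerate singular `n`-cubes. -/
noncomputable def degenerateChains (n : ℕ) : Submodule ℤ (FreeChains G n) :=
  Submodule.span ℤ {c | ∃ σ : SingularCube G n, σ.IsDegenerate ∧ c = Finsupp.single σ 1}

theorem degenerateChains_le (n : ℕ) :
    degenerateChains G (n + 1) ≤ (degenerateChains G n).comap (boundaryQ G n) := by
  rw [degenerateChains, Submodule.span_le]
  rintro _ ⟨σ, ⟨i, hi⟩, rfl⟩
  rw [SetLike.mem_coe, Submodule.mem_comap, boundaryQ_single]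
  refine Submodule.sum_mem _ fun j _ => Submodule.smul_mem _ _ ?_
  by_cases hji : j = i
  · subst hji
    rw [(σ.face_eq_face_iff j).2 hi, sub_self]
    exact Submodule.zero_mem _
  · obtain ⟨k, rfl⟩ := Fin.exists_succAbove_eq (Ne.symm hji)
    have hd : ∀ b, (σ.face j b).IsDegenerate := fun b =>
      ⟨k, fun x => by simpa only [SingularCube.face, Fin.insertNth_update] using hi _⟩
    exact Submodule.sub_mem _ (Submodule.subset_span ⟨_, hd _, rfl⟩)
      (Submodule.subset_span ⟨_, hd _, rfl⟩)

/-- The normalized singular cubical chains `C_n(G) = Q_n(G) / D_n(G)`. -/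
abbrev Chains (n : ℕ) : Type u := FreeChains G n ⧸ degenerateChains G n

/-- The class in `C_n(G)` of a singular `n`-cube. -/
noncomputable def cubeClass {n : ℕ} (σ : SingularCube G n) : Chains G n :=
  (degenerateChains G n).mkQ (Finsupp.single σ 1)

/-- The boundary operator on the normalized chains `C_*(G)`. -/
noncomputable def boundary (n : ℕ) : Chains G (n + 1) →ₗ[ℤ] Chains G n :=
  Submodule.mapQ _ _ (boundaryQ G n) (degenerateChains_le G n)

theorem boundary_comp (n : ℕ) : boundary G n ∘ₗ boundary G (n + 1) = 0 := by
  refine Submodule.linearMap_qext _ ?_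
  rw [LinearMap.comp_assoc, boundary, boundary, Submodule.mapQ_mkQ, ← LinearMap.comp_assoc,
    Submodule.mapQ_mkQ, LinearMap.comp_assoc, boundaryQ_comp]
  simp

theorem boundary_cubeClass (n : ℕ) (σ : SingularCube G (n + 1)) :
    boundary G n (cubeClass G σ) = ∑ i : Fin (n + 1), (-1 : ℤ) ^ ((i : ℕ) + 1) •
      (cubeClass G (σ.face i false) - cubeClass G (σ.face i true)) := by
  simp only [boundary, cubeClass, Submodule.mkQ_apply, Submodule.mapQ_apply, boundaryQ_single]
  simp only [← Submodule.mkQ_apply, map_sum, map_smul, map_sub]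

/-- The degree filtration: `C_n^k(G)` is the subgroup of `C_n(G)` generated by the singular
`n`-cubes of degree at most `k`. The index `k` is an integer, so that `C_n^{-1}(G) = 0`. -/
noncomputable def degreeFiltration (k : ℤ) (n : ℕ) : Submodule ℤ (Chains G n) :=
  Submodule.span ℤ {c | ∃ σ : SingularCube G n, (σ.degree : ℤ) ≤ k ∧ c = cubeClass G σ}

theorem boundary_mem_degreeFiltration (k : ℤ) (n : ℕ) :
    ∀ c ∈ degreeFiltration G k (n + 1), boundary G n c ∈ degreeFiltration G k n := by
  change degreeFiltration G k (n + 1) ≤ (degreeFiltration G k n).comap (boundary G n)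
  rw [degreeFiltration, Submodule.span_le]
  rintro _ ⟨σ, hσ, rfl⟩
  rw [SetLike.mem_coe, Submodule.mem_comap, boundary_cubeClass]
  have hd : ∀ i b, ((σ.face i b).degree : ℤ) ≤ k := fun i b =>
    le_trans (by exact_mod_cast σ.degree_face_le i b) hσ
  exact Submodule.sum_mem _ fun j _ => Submodule.smul_mem _ _
    (Submodule.sub_mem _ (Submodule.subset_span ⟨_, hd _ _, rfl⟩)
      (Submodule.subset_span ⟨_, hd _ _, rfl⟩))

/-- The boundary operator restricted to the `k`-th step of the degree filtration. -/
noncomputable def filteredBoundary (k : ℤ) (n : ℕ) :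
    degreeFiltration G k (n + 1) →ₗ[ℤ] degreeFiltration G k n :=
  (boundary G n).restrict (boundary_mem_degreeFiltration G k n)

theorem filteredBoundary_comp (k : ℤ) (n : ℕ) :
    filteredBoundary G k n ∘ₗ filteredBoundary G k (n + 1) = 0 := by
  refine LinearMap.ext fun c => Subtype.ext ?_
  exact LinearMap.congr_fun (boundary_comp G n) c.1

/-- The associated graded `C_n^{[k]}(G) = C_n^k(G) / C_n^{k-1}(G)` of the degree filtration. -/
abbrev GradedChains (k : ℤ) (n : ℕ) : Type u :=
  degreeFiltration G k n ⧸ (degreeFiltration G (k - 1) n).submoduleOf (degreeFiltration G k n)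

theorem submoduleOf_le_comap (k : ℤ) (n : ℕ) :
    (degreeFiltration G (k - 1) (n + 1)).submoduleOf (degreeFiltration G k (n + 1)) ≤
      ((degreeFiltration G (k - 1) n).submoduleOf (degreeFiltration G k n)).comap
        (filteredBoundary G k n) :=
  fun c hc => boundary_mem_degreeFiltration G (k - 1) n c.1 hc

/-- The boundary operator induced on the associated graded. -/
noncomputable def gradedBoundary (k : ℤ) (n : ℕ) :
    GradedChains G k (n + 1) →ₗ[ℤ] GradedChains G k n :=
  Submodule.mapQ _ _ (filteredBoundary G k n) (submoduleOf_le_comap G k n)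

theorem gradedBoundary_comp (k : ℤ) (n : ℕ) :
    gradedBoundary G k n ∘ₗ gradedBoundary G k (n + 1) = 0 := by
  refine Submodule.linearMap_qext _ ?_
  rw [LinearMap.comp_assoc, gradedBoundary, gradedBoundary, Submodule.mapQ_mkQ,
    ← LinearMap.comp_assoc, Submodule.mapQ_mkQ, LinearMap.comp_assoc, filteredBoundary_comp]
  simp

/-- The chain complex `C_*^{[k]}(G)` of abelian groups. -/
noncomputable def gradedComplex (k : ℤ) : ChainComplex (ModuleCat.{u} ℤ) ℕ :=
  ChainComplex.of (fun n => ModuleCat.of ℤ (GradedChains G k n))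
    (fun n => ModuleCat.ofHom (gradedBoundary G k n))
    (fun n => by rw [← ModuleCat.ofHom_comp, gradedBoundary_comp]; rfl)

/-- The homology `H_n^{[k]}(G)` of the associated graded complex `C_*^{[k]}(G)`. -/
noncomputable def gradedHomology (k : ℤ) (n : ℕ) : ModuleCat.{u} ℤ :=
  (gradedComplex G k).homology n

end DiscreteCubical

namespace DiscreteCubical

section Functoriality

section Near

variable {V W : Type*} {G : SimpleGraph V} {H : SimpleGraph W}

/-- Two vertices are near if they are equal or adjacent. -/
def Near (G : SimpleGraph V) (v w : V) : Prop := v = w ∨ G.Adj v w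

theorem Near.refl (v : V) : Near G v v := Or.inl rfl

theorem Near.symm {v w : V} (h : Near G v w) : Near G w v :=
  h.imp Eq.symm SimpleGraph.Adj.symm

theorem GraphMap.near (f : GraphMap G H) {v w : V} (h : Near G v w) :
    Near H (f.toFun v) (f.toFun w) := by
  rcases h with rfl | h
  · exact Near.refl _
  · exact f.map_adj' _ _ h

/-- A map of vertices which preserves nearness is a graph map. -/
def GraphMap.ofNear (f : V → W) (h : ∀ v w, G.Adj v w → Near H (f v) (f w)) : GraphMap G H where
  toFun := f
  map_adj' := h

end Near

variable {V W : Type u} {G : SimpleGraph V} {H : SimpleGraph W}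

theorem near_update {n : ℕ} (x : Fin n → Bool) (i : Fin n) (b c : Bool) :
    Near (cube n) (Function.update x i b) (Function.update x i c) := by
  by_cases h : b = c
  · exact Or.inl (by rw [h])
  · refine Or.inr ⟨i, by simpa using h, fun j hj => ?_⟩
    by_contra hji
    simp [Function.update_of_ne hji] at hj

theorem cube_adj_cases {n : ℕ} {x y : Fin n → Bool} (h : (cube n).Adj x y) :
    ∃ i, y = Function.update x i (y i) := by
  obtain ⟨i, -, hi⟩ := h
  refine ⟨i, funext fun j => ?_⟩
  by_cases hj : j = i
  · subst hj; simp
  · rw [Function.update_of_ne hj]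
    by_contra hne
    exact hj (hi j (Ne.symm hne))

/-- The composite of a singular cube with a graph map. -/
def SingularCube.map {n : ℕ} (f : GraphMap G H) (σ : SingularCube G n) : SingularCube H n where
  toFun x := f.toFun (σ.toFun x)
  map_adj' _ _ h := f.near (σ.map_adj' _ _ h)

theorem SingularCube.IsDegenerate.map {n : ℕ} {σ : SingularCube G n} (h : σ.IsDegenerate)
    (f : GraphMap G H) : (σ.map f).IsDegenerate :=
  h.imp fun _ hi x => congrArg f.toFun (hi x)

theorem cubeClass_eq_zero {n : ℕ} {σ : SingularCube G n} (h : σ.IsDegenerate) :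
    cubeClass G σ = 0 :=
  (Submodule.Quotient.mk_eq_zero _).2 (Submodule.subset_span ⟨σ, h, rfl⟩)

theorem Chains.hom_ext {n : ℕ} {M : Type*} [AddCommGroup M] {f g : Chains G n →ₗ[ℤ] M}
    (h : ∀ σ, f (cubeClass G σ) = g (cubeClass G σ)) : f = g :=
  Submodule.linearMap_qext _ (Finsupp.lhom_ext' fun σ => LinearMap.ext_ring (h σ))

/-- A function on singular cubes which vanishes on degenerate cubes extends to chains. -/
noncomputable def Chains.lift {n : ℕ} {M : Type*} [AddCommGroup M] (φ : SingularCube G n → M)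
    (h : ∀ σ : SingularCube G n, σ.IsDegenerate → φ σ = 0) : Chains G n →ₗ[ℤ] M :=
  (degenerateChains G n).liftQ (Finsupp.linearCombination ℤ φ) (by
    rw [degenerateChains, Submodule.span_le]
    rintro _ ⟨σ, hσ, rfl⟩
    simp [h σ hσ])

@[simp] theorem Chains.lift_cubeClass {n : ℕ} {M : Type*} [AddCommGroup M]
    (φ : SingularCube G n → M) (h : ∀ σ : SingularCube G n, σ.IsDegenerate → φ σ = 0)
    (σ : SingularCube G n) : Chains.lift φ h (cubeClass G σ) = φ σ := by
  simp [Chains.lift, cubeClass]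

/-- The map on chains induced by a graph map. -/
noncomputable def mapChains (f : GraphMap G H) (n : ℕ) : Chains G n →ₗ[ℤ] Chains H n :=
  Chains.lift (fun σ => cubeClass H (σ.map f)) fun _ hσ => cubeClass_eq_zero (hσ.map f)

@[simp] theorem mapChains_cubeClass (f : GraphMap G H) {n : ℕ} (σ : SingularCube G n) :
    mapChains f n (cubeClass G σ) = cubeClass H (σ.map f) :=
  Chains.lift_cubeClass _ _ σ

theorem boundary_mapChains (f : GraphMap G H) (n : ℕ) (c : Chains G (n + 1)) :
    boundary H n (mapChains f (n + 1) c) = mapChains f n (boundary G n c) := by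
  suffices h : boundary H n ∘ₗ mapChains f (n + 1) = mapChains f n ∘ₗ boundary G n from
    LinearMap.congr_fun h c
  refine Chains.hom_ext fun σ => ?_
  simp only [LinearMap.comp_apply, mapChains_cubeClass, boundary_cubeClass, map_sum, map_smul,
    map_sub]
  rfl

/-- The prism between a singular cube and its image under a graph map `f` close to the identity. -/
def SingularCube.prism {f : GraphMap G G} (hf : ∀ v, Near G v (f.toFun v)) {n : ℕ}
    (σ : SingularCube G n) : SingularCube G (n + 1) where
  toFun y := bif y 0 then f.toFun (σ.toFun (Fin.tail y)) else σ.toFun (Fin.tail y)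
  map_adj' x y h := by
    obtain ⟨i, hi⟩ := cube_adj_cases h
    rw [hi]
    induction i using Fin.cases with
    | zero =>
      rw [← Function.update_eq_self 0 x, Function.update_idem]
      simp only [Fin.tail_update_zero, Function.update_self]
      cases x 0 <;> cases y 0
      · exact Or.inl rfl
      · exact hf _
      · exact (hf _).symm
      · exact Or.inl rfl
    | succ i =>
      have hn : Near G (σ.toFun (Fin.tail x))
          (σ.toFun (Fin.tail (Function.update x i.succ (y i.succ)))) := by
        rw [Fin.tail_update_succ]
        refine GraphMap.near σ ?_
        conv_lhs => rw [← Function.update_eq_self i (Fin.tail x)]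
        exact near_update _ _ _ _
      rw [Function.update_of_ne (Fin.succ_ne_zero i).symm]
      cases x 0
      · exact hn
      · exact f.near hn

variable {f : GraphMap G G} (hf : ∀ v, Near G v (f.toFun v))

theorem SingularCube.prism_face_zero_false {n : ℕ} (σ : SingularCube G n) :
    (σ.prism hf).face 0 false = σ := by
  ext x; simp [SingularCube.face, SingularCube.prism]

theorem SingularCube.prism_face_zero_true {n : ℕ} (σ : SingularCube G n) :
    (σ.prism hf).face 0 true = σ.map f := by
  ext x; simp [SingularCube.face, SingularCube.prism, SingularCube.map]

theorem SingularCube.prism_face_succ {n : ℕ} (σ : SingularCube G (n + 1)) (i : Fin (n + 1))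
    (b : Bool) : (σ.prism hf).face i.succ b = (σ.face i b).prism hf := by
  ext x
  have h : i.succ.insertNth (α := fun _ => Bool) b x =
      Fin.cons (x 0) (i.insertNth (α := fun _ => Bool) b (Fin.tail x)) := by
    rw [Fin.insertNth_eq_iff]
    refine ⟨by simp, funext fun j => ?_⟩
    induction j using Fin.cases with
    | zero => simp [Fin.removeNth]
    | succ j => simp [Fin.removeNth, Fin.tail]
  simp [SingularCube.face, SingularCube.prism, h]

theorem SingularCube.IsDegenerate.prism {n : ℕ} {σ : SingularCube G n} (h : σ.IsDegenerate) :
    (σ.prism hf).IsDegenerate := by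
  obtain ⟨i, hi⟩ := h
  refine ⟨i.succ, fun x => ?_⟩
  simp [SingularCube.prism, Fin.tail_update_succ, hi,
    Function.update_of_ne (Fin.succ_ne_zero i).symm]

/-- The homotopy on chains between the identity and a graph map close to the identity. -/
noncomputable def prismChains (n : ℕ) : Chains G n →ₗ[ℤ] Chains G (n + 1) :=
  Chains.lift (fun σ => cubeClass G (σ.prism hf)) fun _ hσ => cubeClass_eq_zero (hσ.prism hf)

@[simp] theorem prismChains_cubeClass {n : ℕ} (σ : SingularCube G n) :
    prismChains hf n (cubeClass G σ) = cubeClass G (σ.prism hf) :=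
  Chains.lift_cubeClass _ _ σ

theorem boundary_prismChains (n : ℕ) (c : Chains G (n + 1)) :
    boundary G (n + 1) (prismChains hf (n + 1) c) =
      mapChains f (n + 1) c - c - prismChains hf n (boundary G n c) := by
  suffices h : boundary G (n + 1) ∘ₗ prismChains hf (n + 1) =
      mapChains f (n + 1) - LinearMap.id - prismChains hf n ∘ₗ boundary G n from
    LinearMap.congr_fun h c
  refine Chains.hom_ext fun σ => ?_
  simp only [LinearMap.comp_apply, LinearMap.sub_apply, LinearMap.id_apply, mapChains_cubeClass,
    prismChains_cubeClass, boundary_cubeClass, map_sum, map_smul, map_sub]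
  rw [Fin.sum_univ_succ]
  simp only [SingularCube.prism_face_zero_false, SingularCube.prism_face_zero_true,
    SingularCube.prism_face_succ, Fin.val_zero, Fin.val_succ, pow_succ _ (_ + 1), mul_neg, mul_one,
    neg_smul, Finset.sum_neg_distrib]
  simp
  abel

theorem mapChains_pow_cubeClass (f : GraphMap G G) {n : ℕ} (σ : SingularCube G n) (k : ℕ) :
    (mapChains f n ^ k) (cubeClass G σ) = cubeClass G ((SingularCube.map f)^[k] σ) := by
  induction k with
  | zero => rfl
  | succ k ih =>
    rw [pow_succ', Module.End.mul_apply, ih, mapChains_cubeClass, Function.iterate_succ_apply']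

theorem map_iterate_toFun (f : GraphMap G G) {n : ℕ} (σ : SingularCube G n) (k : ℕ)
    (x : Fin n → Bool) : ((SingularCube.map f)^[k] σ).toFun x = f.toFun^[k] (σ.toFun x) := by
  induction k with
  | zero => rfl
  | succ k ih =>
    rw [Function.iterate_succ_apply', Function.iterate_succ_apply', ← ih]
    rfl

theorem boundary_mapChains_pow (f : GraphMap G G) (n : ℕ) (k : ℕ) (c : Chains G (n + 1)) :
    boundary G n ((mapChains f (n + 1) ^ k) c) = (mapChains f n ^ k) (boundary G n c) := by
  induction k with
  | zero => rfl
  | succ k ih =>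
    rw [pow_succ', Module.End.mul_apply, boundary_mapChains, ih, pow_succ', Module.End.mul_apply]

/-- A property of the tails of a sequence of linear maps holds on all chains if it holds on
singular cubes. -/
theorem Chains.eventually_eq_zero {n : ℕ} {M : Type*} [AddCommGroup M]
    (F : ℕ → Chains G n →ₗ[ℤ] M)
    (h : ∀ σ, ∃ N, ∀ k ≥ N, F k (cubeClass G σ) = 0) (c : Chains G n) :
    ∃ N, ∀ k ≥ N, F k c = 0 := by
  obtain ⟨c, rfl⟩ := Submodule.mkQ_surjective _ c
  induction c using Finsupp.induction_linear with
  | zero => exact ⟨0, fun k _ => by simp⟩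
  | add a b ha hb =>
    obtain ⟨N, hN⟩ := ha
    obtain ⟨N', hN'⟩ := hb
    refine ⟨max N N', fun k hk => ?_⟩
    rw [map_add, map_add, hN k (le_trans (le_max_left _ _) hk),
      hN' k (le_trans (le_max_right _ _) hk), add_zero]
  | single σ a =>
    obtain ⟨N, hN⟩ := h σ
    refine ⟨N, fun k hk => ?_⟩
    have : Finsupp.single σ a = a • Finsupp.single σ (1 : ℤ) := by simp
    rw [this, map_smul, map_smul]
    exact (congrArg (a • ·) (hN k hk)).trans (smul_zero a)

/-- The sum of a sequence of linear maps which is pointwise eventually zero. -/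
noncomputable def eventualSum {M M' : Type*} [AddCommGroup M] [AddCommGroup M']
    (F : ℕ → M →ₗ[ℤ] M') (h : ∀ c, ∃ N, ∀ k ≥ N, F k c = 0) : M →ₗ[ℤ] M' :=
  have hs : ∀ c, (Function.support fun k => F k c).Finite := fun c => by
    obtain ⟨N, hN⟩ := h c
    refine (Set.finite_lt_nat N).subset fun k hk => ?_
    by_contra hlt
    exact hk (hN k (not_lt.1 hlt))
  { toFun := fun c => ∑ᶠ k, F k c
    map_add' := fun a b => by
      simp only [map_add]
      exact finsum_add_distrib (hs a) (hs b)
    map_smul' := fun a b => by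
      simp only [map_smul]
      exact (smul_finsum' a (hs b)).symm }

theorem eventualSum_apply {M M' : Type*} [AddCommGroup M] [AddCommGroup M']
    (F : ℕ → M →ₗ[ℤ] M') (h : ∀ c, ∃ N, ∀ k ≥ N, F k c = 0) (c : M) (N : ℕ)
    (hN : ∀ k ≥ N, F k c = 0) : eventualSum F h c = ∑ k ∈ Finset.range N, F k c := by
  refine finsum_eq_sum_of_support_subset _ fun k hk => ?_
  by_contra hlt
  exact hk (hN k (by simpa using hlt))

end Functoriality

section ReducedWalks

variable {V : Type u} {G : SimpleGraph V}

/-- The list `l` of vertices, read from its end, is a walk in `G` without backtracking. -/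
inductive IsReduced (G : SimpleGraph V) : List V → Prop
  | single (v : V) : IsReduced G [v]
  | cons {a b : V} {l : List V} : G.Adj a b → l.head? ≠ some a → IsReduced G (b :: l) →
      IsReduced G (a :: b :: l)

theorem IsReduced.ne_nil {l : List V} (h : IsReduced G l) : l ≠ [] := by
  cases h <;> simp

variable (G) in
/-- The reduced walks of `G`. They are the vertices of the universal covers of `G` based at the
vertices of `G`. -/
abbrev ReducedWalk : Type u := {l : List V // IsReduced G l}

namespace ReducedWalk

/-- The walk of length zero at a vertex. -/
def nil (v : V) : ReducedWalk G := ⟨[v], .single v⟩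

/-- The last vertex of a reduced walk. -/
def endpoint (t : ReducedWalk G) : V := t.1.head t.2.ne_nil

/-- The first vertex of a reduced walk. -/
def root (t : ReducedWalk G) : V := t.1.getLast t.2.ne_nil

open Classical in
/-- The walk without its last step. -/
noncomputable def parent (t : ReducedWalk G) : ReducedWalk G :=
  if h : IsReduced G t.1.tail then ⟨t.1.tail, h⟩ else t

theorem parent_nil (v : V) : parent (nil v : ReducedWalk G) = nil v :=
  dif_neg fun h => h.ne_nil rfl

theorem parent_of_eq_cons {s t : ReducedWalk G} {a : V} (h : t.1 = a :: s.1) : parent t = s := by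
  have : t.1.tail = s.1 := by rw [h, List.tail_cons]
  rw [parent, dif_pos (this ▸ s.2)]
  exact Subtype.ext this

/-- Every reduced walk is constant or extends a reduced walk by one step. -/
theorem eq_nil_or_eq_cons (t : ReducedWalk G) :
    (∃ v, t = nil v) ∨ ∃ (a : V) (s : ReducedWalk G), t.1 = a :: s.1 ∧ G.Adj a s.endpoint ∧
      s.1.tail.head? ≠ some a := by
  obtain ⟨l, h⟩ := t
  cases h with
  | single v => exact Or.inl ⟨v, rfl⟩
  | cons h1 h2 h3 => exact Or.inr ⟨_, ⟨_, h3⟩, rfl, h1, h2⟩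

@[elab_as_elim]
theorem induction {P : ReducedWalk G → Prop} (hnil : ∀ v, P (nil v))
    (hcons : ∀ (a : V) (s t : ReducedWalk G), t.1 = a :: s.1 → P s → P t) (t : ReducedWalk G) :
    P t := by
  obtain ⟨l, h⟩ := t
  induction h with
  | single v => exact hnil v
  | cons h1 h2 h3 ih => exact hcons _ ⟨_, h3⟩ _ rfl ih

end ReducedWalk

open ReducedWalk

variable (G) in
/-- The forest of reduced walks. -/
def walkForest : SimpleGraph (ReducedWalk G) where
  Adj s t := (∃ a, t.1 = a :: s.1) ∨ ∃ a, s.1 = a :: t.1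
  symm := ⟨fun _ _ h => h.symm⟩
  loopless := ⟨fun t h => by rcases h with ⟨a, h⟩ | ⟨a, h⟩ <;> simpa using congrArg List.length h⟩

namespace ReducedWalk

theorem endpoint_of_eq_cons {t : ReducedWalk G} {a : V} {l : List V} (h : t.1 = a :: l) :
    t.endpoint = a := by
  simp [endpoint, h]

theorem adj_of_eq_cons {s t : ReducedWalk G} {a : V} (h : t.1 = a :: s.1) :
    G.Adj a s.endpoint ∧ s.1.tail.head? ≠ some a := by
  rcases t.eq_nil_or_eq_cons with ⟨v, rfl⟩ | ⟨b, s', h1, h2, h3⟩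
  · obtain ⟨-, h⟩ := List.cons_eq_cons.1 h
    exact absurd h.symm s.2.ne_nil
  · obtain ⟨rfl, hs⟩ := List.cons_eq_cons.1 (h1.symm.trans h)
    obtain rfl := Subtype.ext hs
    exact ⟨h2, h3⟩

theorem root_of_eq_cons {s t : ReducedWalk G} {a : V} (h : t.1 = a :: s.1) :
    t.root = s.root := by
  simp [root, h, List.getLast_cons s.2.ne_nil]

theorem root_eq_of_near {s t : ReducedWalk G} (h : Near (walkForest G) s t) :
    s.root = t.root := by
  rcases h with rfl | ⟨a, h⟩ | ⟨a, h⟩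
  · rfl
  · exact (root_of_eq_cons h).symm
  · exact root_of_eq_cons h

variable (G) in
/-- The projection of the forest of reduced walks to the graph. -/
def proj : GraphMap (walkForest G) G :=
  GraphMap.ofNear endpoint fun s t h => by
    rcases h with ⟨a, h⟩ | ⟨a, h⟩
    · rw [endpoint_of_eq_cons h]
      exact Or.inr (adj_of_eq_cons h).1.symm
    · rw [endpoint_of_eq_cons h]
      exact Or.inr (adj_of_eq_cons h).1

theorem near_parent (t : ReducedWalk G) : Near (walkForest G) t (parent t) := by
  rcases t.eq_nil_or_eq_cons with ⟨v, rfl⟩ | ⟨a, s, h, -⟩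
  · exact Or.inl (parent_nil v).symm
  · rw [parent_of_eq_cons h]
    exact Or.inr (Or.inr ⟨a, h⟩)

variable (G) in
/-- Removing the last step is a graph map. -/
noncomputable def parentMap : GraphMap (walkForest G) (walkForest G) :=
  GraphMap.ofNear parent fun s t h => by
    rcases h with ⟨a, h⟩ | ⟨a, h⟩
    · rw [parent_of_eq_cons h]
      exact (near_parent s).symm
    · rw [parent_of_eq_cons h]
      exact near_parent t

theorem near_parentMap (t : ReducedWalk G) :
    Near (walkForest G) t ((parentMap G).toFun t) := near_parent t

theorem parent_iterate (t : ReducedWalk G) {k : ℕ} (hk : t.1.length ≤ k) :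
    parent^[k] t = nil t.root := by
  induction t using ReducedWalk.induction generalizing k with
  | hnil v =>
    clear hk
    induction k with
    | zero => rfl
    | succ k ih => rw [Function.iterate_succ_apply, parent_nil, ih]
  | hcons a s t h ih =>
    obtain ⟨k, rfl⟩ : ∃ j, k = j + 1 := ⟨k - 1, by rw [h] at hk; simp at hk; omega⟩
    rw [Function.iterate_succ_apply, parent_of_eq_cons h, root_of_eq_cons h]
    exact ih (by rw [h] at hk; simpa using hk)

open Classical in
/-- Extending a reduced walk by a step to `x`, with cancellation of backtracking. -/
noncomputable def step (x : V) (t : ReducedWalk G) : ReducedWalk G :=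
  if h : G.Adj x t.endpoint then
    if h' : t.1.tail.head? = some x then parent t
    else ⟨x :: t.1, by
      obtain ⟨l, hl⟩ := t
      cases hl with
      | single v => exact .cons h h' (.single v)
      | cons h1 h2 h3 => exact .cons h h' (.cons h1 h2 h3)⟩
  else t

theorem near_step (x : V) (t : ReducedWalk G) : Near (walkForest G) t (step x t) := by
  unfold step
  split_ifs
  · exact near_parent t
  · exact Or.inr (Or.inl ⟨x, rfl⟩)
  · exact Near.refl t

theorem step_endpoint (t : ReducedWalk G) : step t.endpoint t = t :=
  dif_neg (G.irrefl)

theorem endpoint_step {x : V} {t : ReducedWalk G} (h : Near G x t.endpoint) :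
    (step x t).endpoint = x := by
  unfold step
  split_ifs with h1 h2
  · rcases t.eq_nil_or_eq_cons with ⟨v, rfl⟩ | ⟨a, s, h3, -⟩
    · simp [nil] at h2
    · rw [parent_of_eq_cons h3]
      rw [h3, List.tail_cons, List.head?_eq_some_head s.2.ne_nil] at h2
      exact Option.some.inj h2
  · rfl
  · exact (h.resolve_right h1).symm

theorem eq_step {s t : ReducedWalk G} (h : Near (walkForest G) s t) : t = step t.endpoint s := by
  rcases h with rfl | ⟨a, h⟩ | ⟨a, h⟩
  · exact (step_endpoint _).symm
  · obtain ⟨h1, h2⟩ := adj_of_eq_cons h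
    rw [endpoint_of_eq_cons h, step, dif_pos h1, dif_neg h2]
    exact Subtype.ext h
  · have h1 := (adj_of_eq_cons h).1
    have h2 : s.1.tail.head? = some t.endpoint := by
      rw [h, List.tail_cons, List.head?_eq_some_head t.2.ne_nil]
      rfl
    rw [step, dif_pos (by rw [endpoint_of_eq_cons h]; exact h1.symm), dif_pos h2,
      parent_of_eq_cons h]

theorem eq_of_near {s t t' : ReducedWalk G} (h : Near (walkForest G) s t)
    (h' : Near (walkForest G) s t') (he : t.endpoint = t'.endpoint) : t = t' := by
  rw [eq_step h, eq_step h', he]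

/-- The closed walk `a, b, c, d` of length four (with pauses) is null-homotopic as a walk. -/
def IsThin (a b c d : V) : Prop := a = c ∨ b = d ∨ (a = b ∧ c = d) ∨ (a = d ∧ b = c)

theorem isThin_of_cliqueFree (hG : G.CliqueFree 3) {a b c d : V} (hab : Near G a b)
    (hbc : Near G b c) (hcd : Near G c d) (hda : Near G d a)
    (h : a = b ∨ b = c ∨ c = d ∨ d = a ∨ a = c ∨ b = d) : IsThin a b c d := by
  have tri : ∀ {x y z : V}, Near G x y → Near G y z → Near G z x → x = y ∨ y = z ∨ z = x := by
    intro x y z h1 h2 h3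
    rcases h1 with h1 | h1
    · exact Or.inl h1
    rcases h2 with h2 | h2
    · exact Or.inr (Or.inl h2)
    rcases h3 with h3 | h3
    · exact Or.inr (Or.inr h3)
    classical
    exact (hG {x, y, z} (SimpleGraph.is3Clique_triple_iff.2 ⟨h1, h3.symm, h2⟩)).elim
  unfold IsThin
  rcases h with rfl | rfl | rfl | rfl | h | h
  · have := tri hbc hcd hda
    tauto
  · have := tri hab hcd hda
    tauto
  · have := tri hab hbc hda
    tauto
  · have := tri hab hbc hcd
    tauto
  · exact Or.inl h
  · exact Or.inr (Or.inl h)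

theorem step_step_self {x : V} {t : ReducedWalk G} (h : Near G x t.endpoint) :
    step x (step x t) = step x t := by
  conv_lhs => rw [← endpoint_step h]
  rw [endpoint_step h]
  conv_lhs => arg 1; rw [← endpoint_step h]
  rw [step_endpoint]

theorem step_endpoint_step (x : V) (t : ReducedWalk G) : step t.endpoint (step x t) = t :=
  (eq_step (near_step x t).symm).symm

theorem step_step_of_isThin {b c d : V} {t : ReducedWalk G} (hb : Near G b t.endpoint)
    (hd : Near G d t.endpoint) (h : IsThin t.endpoint b c d) :
    step c (step b t) = step c (step d t) := by
  rcases h with rfl | rfl | ⟨rfl, rfl⟩ | ⟨rfl, rfl⟩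
  · rw [step_endpoint_step, step_endpoint_step]
  · rfl
  · rw [step_endpoint, step_step_self hd]
  · rw [step_endpoint, step_step_self hb]

open Classical in
/-- The walk obtained from `t` by changing its first vertex to a vertex `w` near to it. Walks which
do not start near `w` are left alone. -/
noncomputable def reroot (w : V) (t : ReducedWalk G) : ReducedWalk G :=
  if Near G w t.root then t.1.foldr step (nil w) else t

theorem reroot_of_eq_cons {w : V} {s t : ReducedWalk G} {a : V} (h : t.1 = a :: s.1)
    (hw : Near G w s.root) : reroot w t = step a (reroot w s) := by
  rw [reroot, reroot, if_pos hw, if_pos (by rwa [root_of_eq_cons h]), h, List.foldr_cons]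

theorem reroot_of_not_near {w : V} {t : ReducedWalk G} (hw : ¬Near G w t.root) :
    reroot w t = t := if_neg hw

theorem reroot_nil {w v : V} (hw : Near G w v) :
    reroot w (nil v : ReducedWalk G) = step v (nil w) := if_pos hw

theorem endpoint_reroot (w : V) (t : ReducedWalk G) : (reroot w t).endpoint = t.endpoint := by
  by_cases hw : Near G w t.root
  · induction t using ReducedWalk.induction with
    | hnil v =>
      change Near G w v at hw
      rw [reroot_nil hw]
      exact endpoint_step hw.symm
    | hcons a s t h ih =>
      rw [root_of_eq_cons h] at hw
      rw [reroot_of_eq_cons h hw, endpoint_of_eq_cons h]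
      refine endpoint_step ?_
      rw [ih hw]
      exact Or.inr (adj_of_eq_cons h).1
  · rw [reroot_of_not_near hw]

/-- Changing the first vertex is a graph map. -/
noncomputable def rerootMap (w : V) : GraphMap (walkForest G) (walkForest G) :=
  GraphMap.ofNear (reroot w) (by
    have key : ∀ (s t : ReducedWalk G) (a : V), t.1 = a :: s.1 →
        Near (walkForest G) (reroot w s) (reroot w t) := by
      intro s t a h
      by_cases hw : Near G w s.root
      · rw [reroot_of_eq_cons h hw]
        exact near_step _ _
      · rw [reroot_of_not_near hw, reroot_of_not_near (by rwa [root_of_eq_cons h])]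
        exact Or.inr (Or.inl ⟨a, h⟩)
    rintro s t (⟨a, h⟩ | ⟨a, h⟩)
    · exact key _ _ a h
    · exact (key _ _ a h).symm)

theorem reroot_step (w : V) {a : V} {t : ReducedWalk G} (h : Near G a t.endpoint) :
    reroot w (step a t) = step a (reroot w t) := by
  have := eq_step ((rerootMap w).near (near_step a t))
  change reroot w (step a t) = step (reroot w (step a t)).endpoint (reroot w t) at this
  rwa [endpoint_reroot, endpoint_step h] at this

theorem reroot_reroot {u w : V} {t : ReducedWalk G} (hu : Near G u t.root) (hw : Near G w u)
    (hw' : Near G w t.root) (h : u = t.root ∨ u = w ∨ w = t.root) :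
    reroot w (reroot u t) = reroot w t := by
  induction t using ReducedWalk.induction with
  | hnil v =>
    change Near G u v at hu
    change Near G w v at hw'
    change u = v ∨ u = w ∨ w = v at h
    rw [reroot_nil hu, reroot_nil hw', reroot_step w (t := nil u) hu.symm, reroot_nil hw]
    have hn : (nil w : ReducedWalk G).endpoint = w := rfl
    rcases h with rfl | rfl | rfl
    · exact step_step_self hw.symm
    · exact congrArg _ (step_endpoint (nil u))
    · exact (step_endpoint_step u (nil w)).trans (step_endpoint (nil w)).symm
  | hcons a s t ht ih =>
    rw [root_of_eq_cons ht] at hu hw' h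
    rw [reroot_of_eq_cons ht hu, reroot_of_eq_cons ht hw', reroot_step, ih hu hw' h]
    rw [endpoint_reroot]
    exact Or.inr (adj_of_eq_cons ht).1

theorem reroot_root (t : ReducedWalk G) : reroot t.root t = t := by
  induction t using ReducedWalk.induction with
  | hnil v => exact (reroot_nil (Near.refl v)).trans (step_endpoint (nil v))
  | hcons a s t ht ih =>
    rw [root_of_eq_cons ht, reroot_of_eq_cons ht (Near.refl _), ih]
    refine ((eq_step (Or.inr (Or.inl ⟨a, ht⟩))).trans ?_).symm
    rw [endpoint_of_eq_cons ht]

end ReducedWalk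

end ReducedWalks

section Squares

variable {V : Type u} {G : SimpleGraph V}

/-- The vertices of the two-dimensional face of a cube in the directions `i` and `j`. -/
def squareVertex {n : ℕ} (x : Fin n → Bool) (i j : Fin n) (b c : Bool) : Fin n → Bool :=
  Function.update (Function.update x i b) j c

theorem squareVertex_near_right {n : ℕ} (x : Fin n → Bool) (i j : Fin n) (b c c' : Bool) :
    Near (cube n) (squareVertex x i j b c) (squareVertex x i j b c') :=
  near_update _ _ _ _

theorem squareVertex_near_left {n : ℕ} (x : Fin n → Bool) {i j : Fin n} (hij : i ≠ j)
    (b b' c : Bool) : Near (cube n) (squareVertex x i j b c) (squareVertex x i j b' c) := by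
  have h (b : Bool) : squareVertex x i j b c = Function.update (Function.update x j c) i b :=
    Function.update_comm (β := fun _ => Bool) hij b c x
  rw [h, h]
  exact near_update _ _ _ _

/-- The square of a singular cube of degree at most one is not injective. -/
theorem SingularCube.exists_square_eq {n : ℕ} {σ : SingularCube G n} (hσ : σ.degree ≤ 1)
    (x : Fin n → Bool) {i j : Fin n} (hij : i ≠ j) :
    ∃ b c b' c', (b ≠ b' ∨ c ≠ c') ∧
      σ.toFun (squareVertex x i j b c) = σ.toFun (squareVertex x i j b' c') := by
  have hn : ¬Set.InjOn σ.toFun (cubeFace {i, j} x) := fun hinj => by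
    have := (σ.degree_le_iff 1).1 hσ {i, j} x hinj
    rw [Finset.card_pair hij] at this
    omega
  have hrep : ∀ y ∈ cubeFace {i, j} x, y = squareVertex x i j (y i) (y j) := by
    intro y hy
    funext k
    rw [squareVertex]
    by_cases hkj : k = j
    · subst hkj; simp
    by_cases hki : k = i
    · subst hki; simp [Function.update_of_ne hkj]
    · rw [Function.update_of_ne hkj, Function.update_of_ne hki]
      exact hy k (by simp [hki, hkj])
  simp only [Set.InjOn, not_forall] at hn
  obtain ⟨y, hy, z, hz, hyz, hne⟩ := hn
  refine ⟨y i, y j, z i, z j, ?_, by rwa [← hrep y hy, ← hrep z hz]⟩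
  by_contra! hcon
  exact hne (by rw [hrep y hy, hrep z hz, hcon.1, hcon.2])

theorem SingularCube.isThin_square (hG : G.CliqueFree 3) {n : ℕ} {σ : SingularCube G n}
    (hσ : σ.degree ≤ 1) (x : Fin n → Bool) {i j : Fin n} (hij : i ≠ j) (b c b' c' : Bool) :
    ReducedWalk.IsThin (σ.toFun (squareVertex x i j b c)) (σ.toFun (squareVertex x i j b' c))
      (σ.toFun (squareVertex x i j b' c')) (σ.toFun (squareVertex x i j b c')) := by
  by_cases hb : b = b'
  · subst hb
    exact Or.inr (Or.inr (Or.inl ⟨rfl, rfl⟩))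
  by_cases hc : c = c'
  · subst hc
    exact Or.inr (Or.inr (Or.inr ⟨rfl, rfl⟩))
  refine ReducedWalk.isThin_of_cliqueFree hG (σ.near (squareVertex_near_left x hij _ _ _))
    (σ.near (squareVertex_near_right x i j _ _ _)) (σ.near (squareVertex_near_left x hij _ _ _))
    (σ.near (squareVertex_near_right x i j _ _ _)) ?_
  obtain ⟨d, e, d', e', hne, heq⟩ := exists_square_eq hσ x hij
  generalize hF : (fun b c => σ.toFun (squareVertex x i j b c)) = F
  have hF' : ∀ b c, σ.toFun (squareVertex x i j b c) = F b c := fun b c => by rw [← hF]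
  simp only [hF'] at heq ⊢
  cases b <;> cases b' <;> cases c <;> cases c' <;>
    first
    | exact absurd rfl hb
    | exact absurd rfl hc
    | skip
  all_goals
    cases d <;> cases d' <;> cases e <;> cases e' <;> simp_all

end Squares

section Lifts

variable {V : Type u} {G : SimpleGraph V}

open ReducedWalk

/-- The value of a singular cube at the vertex `(0, …, 0)`. -/
def SingularCube.base {n : ℕ} (σ : SingularCube G n) : V := σ.toFun fun _ => false

theorem SingularCube.base_face_false {n : ℕ} (σ : SingularCube G (n + 1)) (i : Fin (n + 1)) :
    (σ.face i false).base = σ.base := by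
  refine congrArg σ.toFun ?_
  rw [Fin.insertNth_eq_iff]
  exact ⟨rfl, rfl⟩

theorem SingularCube.base_face {n : ℕ} (σ : SingularCube G (n + 1)) (i : Fin (n + 1)) (b : Bool) :
    (σ.face i b).base = σ.toFun (Function.update (fun _ => false) i b) := by
  refine congrArg σ.toFun ?_
  rw [Fin.insertNth_eq_iff]
  exact ⟨by simp, by funext j; simp [Fin.removeNth]⟩

theorem SingularCube.base_face_face {n : ℕ} (σ : SingularCube G (n + 2)) (j : Fin (n + 2))
    (i : Fin (n + 1)) (b c : Bool) :
    ((σ.face j b).face i c).base =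
      σ.toFun (squareVertex (fun _ => false) j (j.succAbove i) b c) := by
  rw [SingularCube.base_face]
  refine congrArg σ.toFun ?_
  rw [Fin.insertNth_update, squareVertex]
  congr 1
  rw [Fin.insertNth_eq_iff]
  exact ⟨by simp, by funext k; simp [Fin.removeNth]⟩

theorem SingularCube.near_base_face {n : ℕ} (σ : SingularCube G (n + 1)) (i : Fin (n + 1)) :
    Near G σ.base (σ.face i true).base := by
  rw [← σ.base_face_false i, SingularCube.base_face, SingularCube.base_face]
  exact GraphMap.near _ (near_update _ _ _ _)

/-- A property of vertices of the cube holds everywhere if it holds at the origin and passes to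
neighbours. -/
theorem cube_induction {n : ℕ} {P : (Fin n → Bool) → Prop} (h0 : P fun _ => false)
    (hs : ∀ x y, Near (cube n) x y → P x → P y) (x : Fin n → Bool) : P x := by
  have key : ∀ s : Finset (Fin n), P fun i => decide (i ∈ s) := by
    intro s
    induction s using Finset.induction_on with
    | empty => simpa using h0
    | insert a s _ ih =>
      refine hs _ _ ?_ ih
      have h1 := near_update (fun i => decide (i ∈ s)) a (decide (a ∈ s)) true
      rw [Function.update_eq_self] at h1
      convert h1 using 1
      funext i
      by_cases hi : i = a
      · subst hi; simp
      · simp [hi]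
  simpa using key {i | x i = true}

theorem eq_of_map_proj_eq {n : ℕ} {τ τ' : SingularCube (walkForest G) n}
    (h : τ.map (proj G) = τ'.map (proj G)) (hb : τ.base = τ'.base) : τ = τ' := by
  ext x
  revert x
  suffices h' : ∀ x, τ.toFun x = τ'.toFun x by
    intro x; rw [h' x]
  intro x
  induction x using cube_induction with
  | h0 => exact hb
  | hs x y hxy ih =>
    refine eq_of_near (τ.near hxy) (ih ▸ τ'.near hxy) ?_
    exact congrFun (congrArg GraphMap.toFun h) y

theorem root_eq_root_base {n : ℕ} (τ : SingularCube (walkForest G) n) (x : Fin n → Bool) :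
    (τ.toFun x).root = τ.base.root := by
  induction x using cube_induction with
  | h0 => rfl
  | hs x y hxy ih => rw [← ih, root_eq_of_near (τ.near hxy)]

theorem exists_lift (hG : G.CliqueFree 3) {n : ℕ} (σ : SingularCube G n) (hσ : σ.degree ≤ 1)
    (t : ReducedWalk G) (ht : t.endpoint = σ.base) :
    ∃ τ : SingularCube (walkForest G) n, τ.map (proj G) = σ ∧ τ.base = t := by
  induction n with
  | zero =>
    refine ⟨⟨fun _ => t, fun _ _ _ => Or.inl rfl⟩, ?_, rfl⟩
    ext x
    exact ht.trans (congrArg σ.toFun (Subsingleton.elim _ _))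
  | succ n ih =>
    obtain ⟨τ, hτ, hb⟩ := ih (σ.face 0 false) ((σ.degree_face_le 0 false).trans hσ)
      (ht.trans (σ.base_face_false 0).symm)
    have hend (y : Fin (n + 1) → Bool) (i : Fin n) : (τ.toFun (Fin.tail y)).endpoint =
        σ.toFun (squareVertex y 0 i.succ false (y i.succ)) := by
      refine (congrFun (congrArg GraphMap.toFun hτ) (Fin.tail y)).trans (congrArg σ.toFun ?_)
      rw [Fin.insertNth_eq_iff, squareVertex]
      refine ⟨by simp [Function.update_of_ne (Fin.succ_ne_zero i).symm], funext fun j => ?_⟩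
      by_cases hj : j = i
      · subst hj; simp [Fin.removeNth, Fin.tail]
      · simp [Fin.removeNth, Fin.tail, hj]
    have hend' (y : Fin (n + 1) → Bool) : (τ.toFun (Fin.tail y)).endpoint =
        σ.toFun (Function.update y 0 false) := by
      refine (congrFun (congrArg GraphMap.toFun hτ) (Fin.tail y)).trans (congrArg σ.toFun ?_)
      rw [Fin.insertNth_eq_iff]
      refine ⟨by simp, funext fun j => ?_⟩
      simp [Fin.removeNth, Fin.tail]
    have hnear (y : Fin (n + 1) → Bool) :
        Near G (σ.toFun y) (τ.toFun (Fin.tail y)).endpoint := by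
      rw [hend']
      refine σ.near ?_
      conv_lhs => rw [← Function.update_eq_self 0 y]
      exact near_update _ _ _ _
    let F : (Fin (n + 1) → Bool) → ReducedWalk G := fun y => step (σ.toFun y) (τ.toFun (Fin.tail y))
    have hF (y : Fin (n + 1) → Bool) (h : y 0 = false) : F y = τ.toFun (Fin.tail y) := by
      have : σ.toFun y = (τ.toFun (Fin.tail y)).endpoint := by
        rw [hend', ← h, Function.update_eq_self]
      simp only [F, this, step_endpoint]
    refine ⟨GraphMap.ofNear F fun y z hyz => ?_, ?_, ?_⟩
    · obtain ⟨i, hi⟩ := cube_adj_cases hyz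
      induction i using Fin.cases with
      | zero =>
        have htail : Fin.tail z = Fin.tail y := by rw [hi, Fin.tail_update_zero]
        cases hy : y 0
        · rw [hF y hy, ← htail]
          exact near_step _ _
        · cases hz : z 0
          · rw [hF z hz, htail]
            exact (near_step _ _).symm
          · rw [hz, ← hy, Function.update_eq_self] at hi
            rw [hi]
            exact Near.refl _
      | succ i =>
        have htail : Fin.tail z = Function.update (Fin.tail y) i (z i.succ) := by
          conv_lhs => rw [hi]
          rw [Fin.tail_update_succ]
        have hn : Near (walkForest G) (τ.toFun (Fin.tail y)) (τ.toFun (Fin.tail z)) := by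
          refine τ.near ?_
          rw [htail]
          conv_lhs => rw [← Function.update_eq_self i (Fin.tail y)]
          exact near_update _ _ _ _
        have hz0 : squareVertex y 0 i.succ (y 0) (z i.succ) = z := by
          rw [squareVertex, Function.update_eq_self]
          exact hi.symm
        have hy0 : squareVertex y 0 i.succ (y 0) (y i.succ) = y := by
          rw [squareVertex, Function.update_eq_self, Function.update_eq_self]
        have hzf : squareVertex y 0 i.succ false (z i.succ) =
            squareVertex z 0 i.succ false (z i.succ) := by
          conv_rhs => rw [hi]
          rw [squareVertex, squareVertex,
            Function.update_comm (Fin.succ_ne_zero i) _ _ y, Function.update_idem]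
          simp
        have hthin := SingularCube.isThin_square hG hσ y (Fin.succ_ne_zero i).symm false
          (y i.succ) (y 0) (z i.succ)
        rw [hz0, hy0, hzf, ← hend, ← hend] at hthin
        have h1 : F z = step (σ.toFun z) (F y) := by
          rw [show F y = step (σ.toFun y) (τ.toFun (Fin.tail y)) from rfl,
            step_step_of_isThin (d := (τ.toFun (Fin.tail z)).endpoint) (hnear y)
              ((proj G).near hn).symm hthin, ← eq_step hn]
        rw [h1]
        exact near_step _ _
    · ext y
      exact endpoint_step (hnear y)
    · exact (hF _ rfl).trans hb

/-- A lift of a singular cube to the forest of reduced walks, starting at a walk of length zero. -/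
structure IsLift {n : ℕ} (σ : SingularCube G n) (τ : SingularCube (walkForest G) n) : Prop where
  map_proj : τ.map (proj G) = σ
  base_eq : τ.base = nil σ.base

theorem IsLift.unique {n : ℕ} {σ : SingularCube G n} {τ τ' : SingularCube (walkForest G) n}
    (h : IsLift σ τ) (h' : IsLift σ τ') : τ = τ' :=
  eq_of_map_proj_eq (h.map_proj.trans h'.map_proj.symm) (h.base_eq.trans h'.base_eq.symm)

theorem IsLift.root_eq {n : ℕ} {σ : SingularCube G n} {τ : SingularCube (walkForest G) n}
    (h : IsLift σ τ) (x : Fin n → Bool) : (τ.toFun x).root = σ.base := by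
  rw [root_eq_root_base, h.base_eq]
  rfl

theorem IsLift.face_false {n : ℕ} {σ : SingularCube G (n + 1)}
    {τ : SingularCube (walkForest G) (n + 1)} (h : IsLift σ τ) (i : Fin (n + 1)) :
    IsLift (σ.face i false) (τ.face i false) where
  map_proj := congrArg (SingularCube.face i false) h.map_proj
  base_eq := by rw [SingularCube.base_face_false, SingularCube.base_face_false, h.base_eq]

theorem IsLift.face_true {n : ℕ} {σ : SingularCube G (n + 1)}
    {τ : SingularCube (walkForest G) (n + 1)} (h : IsLift σ τ) (i : Fin (n + 1)) :
    IsLift (σ.face i true) ((τ.face i true).map (rerootMap (σ.face i true).base)) where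
  map_proj := by
    ext x
    exact (endpoint_reroot _ _).trans
      (congrFun (congrArg GraphMap.toFun (congrArg (SingularCube.face i true) h.map_proj)) x)
  base_eq := by
    have h1 : Near (walkForest G) τ.base (τ.face i true).base := τ.near_base_face i
    have h2 : (τ.face i true).base.endpoint = (σ.face i true).base :=
      congrArg (fun ρ => (SingularCube.face i true ρ).base) h.map_proj
    have h3 := σ.near_base_face i
    change reroot _ (τ.face i true).base = _
    rw [eq_step h1, h2, h.base_eq, reroot_step _ (t := nil σ.base) h3.symm, reroot_nil h3.symm]
    exact step_endpoint_step σ.base (nil _)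

theorem IsLift.isDegenerate {n : ℕ} {σ : SingularCube G n} {τ : SingularCube (walkForest G) n}
    (h : IsLift σ τ) {i : Fin n}
    (hi : ∀ x, σ.toFun (Function.update x i false) = σ.toFun (Function.update x i true))
    (x : Fin n → Bool) :
    τ.toFun (Function.update x i false) = τ.toFun (Function.update x i true) := by
  refine eq_of_near (Near.refl _) (τ.near (near_update _ _ _ _)) ?_
  have := hi x
  rw [← h.map_proj] at this
  exact this

theorem ReducedWalk.eq_of_adj_longest {a b d : ReducedWalk G} (hb : (walkForest G).Adj a b)
    (hd : (walkForest G).Adj a d) (hbl : b.1.length ≤ a.1.length)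
    (hdl : d.1.length ≤ a.1.length) : b = d := by
  rcases hb with ⟨x, hb⟩ | ⟨x, hb⟩
  · rw [hb] at hbl; simp at hbl
  rcases hd with ⟨y, hd⟩ | ⟨y, hd⟩
  · rw [hd] at hdl; simp at hdl
  exact Subtype.ext (List.cons_eq_cons.1 (hb.symm.trans hd)).2

theorem degree_le_one {n : ℕ} (τ : SingularCube (walkForest G) n) : τ.degree ≤ 1 := by
  rw [SingularCube.degree_le_iff]
  intro S a hS
  by_contra! hcard
  obtain ⟨i, hi, j, hj, hij⟩ := Finset.one_lt_card.1 hcard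
  have hmem (b c : Bool) : squareVertex a i j b c ∈ cubeFace S a := fun k hk => by
    have hki : k ≠ i := fun h => hk (h ▸ hi)
    have hkj : k ≠ j := fun h => hk (h ▸ hj)
    rw [squareVertex, Function.update_of_ne hkj, Function.update_of_ne hki]
  have hinj {b c b' c' : Bool}
      (h : τ.toFun (squareVertex a i j b c) = τ.toFun (squareVertex a i j b' c')) :
      b = b' ∧ c = c' := by
    have h1 := hS (hmem b c) (hmem b' c') h
    have h2 := congrFun h1 i
    have h3 := congrFun h1 j
    simp only [squareVertex, Function.update_of_ne hij, Function.update_self] at h2 h3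
    exact ⟨h2, h3⟩
  have hl (b c : Bool) : (walkForest G).Adj (τ.toFun (squareVertex a i j b c))
      (τ.toFun (squareVertex a i j (!b) c)) :=
    (τ.near (squareVertex_near_left a hij b (!b) c)).resolve_left
      fun h => by simpa using (hinj h).1
  have hr (b c : Bool) : (walkForest G).Adj (τ.toFun (squareVertex a i j b c))
      (τ.toFun (squareVertex a i j b (!c))) :=
    (τ.near (squareVertex_near_right a i j b c (!c))).resolve_left
      fun h => by simpa using (hinj h).2
  obtain ⟨⟨b, c⟩, hmax⟩ := Finite.exists_max
    fun p : Bool × Bool => (τ.toFun (squareVertex a i j p.1 p.2)).1.length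
  have := hinj (ReducedWalk.eq_of_adj_longest (hl b c) (hr b c) (hmax (!b, c)) (hmax (b, !c)))
  simpa using this.1

end Lifts

section Contraction

variable {V : Type u} (G : SimpleGraph V)

open ReducedWalk

theorem eventually_isDegenerate {n : ℕ} (σ : SingularCube (walkForest G) n) :
    ∃ N, ∀ k ≥ N, ∀ x, ((SingularCube.map (parentMap G))^[k] σ).toFun x = nil σ.base.root := by
  obtain ⟨N, hN⟩ := (Set.finite_range fun x => (σ.toFun x).1.length).bddAbove
  refine ⟨N, fun k hk x => ?_⟩
  rw [map_iterate_toFun]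
  refine (parent_iterate _ ((hN ⟨x, rfl⟩).trans hk)).trans ?_
  rw [root_eq_root_base]

theorem eventually_prismChains_eq_zero {n : ℕ} (c : Chains (walkForest G) n) :
    ∃ N, ∀ k ≥ N, (prismChains near_parentMap n ∘ₗ mapChains (parentMap G) n ^ k) c
      = 0 := by
  refine Chains.eventually_eq_zero _ (fun σ => ?_) c
  obtain ⟨N, hN⟩ := eventually_isDegenerate G σ
  refine ⟨N, fun k hk => ?_⟩
  rw [LinearMap.comp_apply, mapChains_pow_cubeClass, prismChains_cubeClass]
  refine cubeClass_eq_zero ⟨0, fun x => ?_⟩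
  simp only [SingularCube.prism, Function.update_self, cond_true, cond_false,
    hN k hk]
  exact (parent_nil _).symm

theorem eventually_mapChains_pow_eq_zero {n : ℕ} (c : Chains (walkForest G) (n + 1)) :
    ∃ N, ∀ k ≥ N, (mapChains (parentMap G) (n + 1) ^ k) c = 0 := by
  refine Chains.eventually_eq_zero (fun k => mapChains (parentMap G) (n + 1) ^ k) (fun σ => ?_) c
  obtain ⟨N, hN⟩ := eventually_isDegenerate G σ
  refine ⟨N, fun k hk => ?_⟩
  rw [mapChains_pow_cubeClass]
  exact cubeClass_eq_zero ⟨0, fun x => by rw [hN k hk, hN k hk]⟩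

/-- The contraction of the chains on the forest of reduced walks to the roots. -/
noncomputable def contraction (n : ℕ) :
    Chains (walkForest G) n →ₗ[ℤ] Chains (walkForest G) (n + 1) :=
  -eventualSum _ (eventually_prismChains_eq_zero G (n := n))

theorem boundary_contraction (n : ℕ) (c : Chains (walkForest G) (n + 1)) :
    boundary _ (n + 1) (contraction G (n + 1) c) = c - contraction G n (boundary _ n c) := by
  obtain ⟨N₁, h₁⟩ := eventually_prismChains_eq_zero G c
  obtain ⟨N₂, h₂⟩ := eventually_prismChains_eq_zero G (boundary _ n c)
  obtain ⟨N₃, h₃⟩ := eventually_mapChains_pow_eq_zero G c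
  obtain ⟨N, hN1, hN2, hN3⟩ : ∃ N, N₁ ≤ N ∧ N₂ ≤ N ∧ N₃ ≤ N :=
    ⟨max N₁ (max N₂ N₃), by simp, by simp, by simp⟩
  rw [contraction, contraction, LinearMap.neg_apply, LinearMap.neg_apply,
    eventualSum_apply _ _ _ N fun k hk => h₁ k (hN1.trans hk),
    eventualSum_apply _ _ _ N fun k hk => h₂ k (hN2.trans hk), map_neg, map_sum]
  have hk (k : ℕ) : boundary (walkForest G) (n + 1)
      ((prismChains near_parentMap (n + 1) ∘ₗ
        mapChains (parentMap G) (n + 1) ^ k) c) =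
      ((mapChains (parentMap G) (n + 1) ^ (k + 1)) c - (mapChains (parentMap G) (n + 1) ^ k) c) -
      (prismChains near_parentMap n ∘ₗ mapChains (parentMap G) n ^ k)
        (boundary _ n c) := by
    rw [LinearMap.comp_apply, boundary_prismChains, boundary_mapChains_pow, LinearMap.comp_apply,
      pow_succ' _ k, Module.End.mul_apply]
  simp only [hk, Finset.sum_sub_distrib]
  rw [← Finset.sum_sub_distrib, Finset.sum_range_sub fun k => (mapChains (parentMap G) (n + 1) ^ k) c,
    h₃ N hN3, pow_zero, Module.End.one_apply]
  abel

end Contraction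

section EdgeHomotopy

variable {V : Type u} {G : SimpleGraph V}

open ReducedWalk

variable (G) in
/-- The projection of chains on the forest of reduced walks to chains on the graph. -/
noncomputable def projChains (n : ℕ) : Chains (walkForest G) n →ₗ[ℤ] Chains G n :=
  mapChains (proj G) n

/-- Change of the first vertex for chains on the forest of reduced walks. -/
noncomputable def rerootChains (w : V) (n : ℕ) :
    Chains (walkForest G) n →ₗ[ℤ] Chains (walkForest G) n :=
  mapChains (rerootMap w) n

theorem rerootChains_cubeClass (w : V) {n : ℕ} (τ : SingularCube (walkForest G) n) :
    rerootChains w n (cubeClass _ τ) = cubeClass _ (τ.map (rerootMap w)) :=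
  mapChains_cubeClass _ τ

theorem projChains_rerootChains (w : V) (n : ℕ) (c : Chains (walkForest G) n) :
    projChains G n (rerootChains w n c) = projChains G n c := by
  suffices h : projChains G n ∘ₗ rerootChains w n = projChains G n from LinearMap.congr_fun h c
  refine Chains.hom_ext fun τ => ?_
  rw [LinearMap.comp_apply, rerootChains_cubeClass, projChains, mapChains_cubeClass,
    mapChains_cubeClass]
  congr 1
  ext x
  exact endpoint_reroot _ _

theorem rerootChains_self {v : V} {n : ℕ} {τ : SingularCube (walkForest G) n}
    (hτ : ∀ x, (τ.toFun x).root = v) : rerootChains v n (cubeClass _ τ) = cubeClass _ τ := by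
  rw [rerootChains_cubeClass]
  congr 1
  refine GraphMap.ext (funext fun x => ?_)
  change reroot v (τ.toFun x) = τ.toFun x
  rw [← hτ x, reroot_root]

theorem rerootChains_rerootChains {u v w : V} {n : ℕ} {τ : SingularCube (walkForest G) n}
    (hτ : ∀ x, (τ.toFun x).root = v) (hu : Near G u v) (hw : Near G w u) (hw' : Near G w v)
    (h : u = v ∨ u = w ∨ w = v) :
    rerootChains w n (rerootChains u n (cubeClass _ τ)) = rerootChains w n (cubeClass _ τ) := by
  rw [rerootChains_cubeClass, rerootChains_cubeClass, rerootChains_cubeClass]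
  congr 1
  refine GraphMap.ext (funext fun x => ?_)
  exact reroot_reroot (by rwa [hτ x]) hw (by rwa [hτ x]) (by rwa [hτ x])

/-- The difference of the contractions towards two vertices, as chains on the forest rooted
at `r`. -/
noncomputable def contractionDiff (r v w : V) (n : ℕ) :
    Chains (walkForest G) n →ₗ[ℤ] Chains (walkForest G) (n + 1) :=
  rerootChains r (n + 1) ∘ₗ contraction G n ∘ₗ (rerootChains v n - rerootChains w n)

/-- The homotopy between the contractions towards two near vertices `v` and `w`. It is
antisymmetric in `v` and `w`. -/
noncomputable def edgeHomotopy (v w : V) (n : ℕ) : Chains (walkForest G) n →ₗ[ℤ] Chains G (n + 2) :=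
  projChains G (n + 2) ∘ₗ contraction G (n + 1) ∘ₗ contractionDiff s(v, w).out.1 v w n

theorem contractionDiff_apply (r v w : V) (n : ℕ) (c : Chains (walkForest G) n) :
    contractionDiff r v w n c = rerootChains r (n + 1)
      (contraction G n (rerootChains v n c) - contraction G n (rerootChains w n c)) := by
  simp [contractionDiff]

theorem edgeHomotopy_apply (v w : V) (n : ℕ) (c : Chains (walkForest G) n) :
    edgeHomotopy v w n c = projChains G (n + 2)
      (contraction G (n + 1) (contractionDiff s(v, w).out.1 v w n c)) := rfl

theorem edgeHomotopy_self (v : V) (n : ℕ) (c : Chains (walkForest G) n) :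
    edgeHomotopy v v n c = 0 := by
  simp [edgeHomotopy_apply, contractionDiff_apply]

theorem edgeHomotopy_swap (v w : V) (n : ℕ) (c : Chains (walkForest G) n) :
    edgeHomotopy w v n c = -edgeHomotopy v w n c := by
  rw [edgeHomotopy_apply, edgeHomotopy_apply, Sym2.eq_swap, contractionDiff_apply,
    contractionDiff_apply, ← map_neg, ← map_neg, ← map_neg, neg_sub]

theorem edgeHomotopy_rerootChains {v w : V} {n : ℕ} {τ : SingularCube (walkForest G) n}
    (hτ : ∀ x, (τ.toFun x).root = v) (h : Near G v w) :
    edgeHomotopy v w n (rerootChains w n (cubeClass _ τ)) = edgeHomotopy v w n (cubeClass _ τ) := by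
  rw [edgeHomotopy_apply, edgeHomotopy_apply, contractionDiff_apply, contractionDiff_apply,
    rerootChains_rerootChains hτ h.symm h (Near.refl v) (Or.inr (Or.inr rfl)),
    rerootChains_rerootChains hτ h.symm (Near.refl w) h.symm (Or.inr (Or.inl rfl))]

theorem edgeHomotopy_square {a b c d : V} {n : ℕ} {τ : SingularCube (walkForest G) n}
    (hτ : ∀ x, (τ.toFun x).root = a) (hab : Near G a b) (had : Near G a d) (h : IsThin a b c d) :
    edgeHomotopy a b n (cubeClass _ τ) + edgeHomotopy b c n (rerootChains b n (cubeClass _ τ)) =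
      edgeHomotopy a d n (cubeClass _ τ) +
        edgeHomotopy d c n (rerootChains d n (cubeClass _ τ)) := by
  rcases h with rfl | rfl | ⟨rfl, rfl⟩ | ⟨rfl, rfl⟩
  · rw [edgeHomotopy_swap a b, edgeHomotopy_swap a d, edgeHomotopy_rerootChains hτ hab,
      edgeHomotopy_rerootChains hτ had, add_neg_cancel, add_neg_cancel]
  · rfl
  · rw [edgeHomotopy_self, edgeHomotopy_self, rerootChains_self hτ, zero_add, add_zero]
  · rw [edgeHomotopy_self, edgeHomotopy_self, rerootChains_self hτ, zero_add, add_zero]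

theorem boundary_edgeHomotopy {v w : V} {n : ℕ} {τ : SingularCube (walkForest G) (n + 1)}
    (hτ : ∀ x, (τ.toFun x).root = v) (h : Near G v w) :
    boundary G (n + 2) (edgeHomotopy v w (n + 1) (cubeClass _ τ)) =
      edgeHomotopy v w n (boundary _ n (cubeClass _ τ)) +
        (projChains G (n + 2) (contraction G (n + 1) (cubeClass _ τ)) -
          projChains G (n + 2) (contraction G (n + 1)
            (rerootChains w (n + 1) (cubeClass _ τ)))) := by
  obtain ⟨r, hr⟩ : ∃ r, s(v, w).out.1 = r := ⟨_, rfl⟩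
  have hr' : r = v ∨ r = w := Sym2.mem_iff.1 (hr ▸ Sym2.out_fst_mem s(v, w))
  have hrv : Near G r v := by
    rcases hr' with rfl | rfl
    · exact Near.refl _
    · exact h.symm
  have hrw : Near G r w := by
    rcases hr' with rfl | rfl
    · exact h
    · exact Near.refl _
  have hw : rerootChains r (n + 1) (rerootChains w (n + 1) (cubeClass _ τ)) =
      rerootChains r (n + 1) (cubeClass _ τ) :=
    rerootChains_rerootChains hτ h.symm hrw hrv
      (by rcases hr' with h' | h' <;> simp [h'])
  have hcomm (u : V) (m : ℕ) (c : Chains (walkForest G) (m + 1)) :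
      boundary _ m (rerootChains u (m + 1) c) = rerootChains u m (boundary _ m c) :=
    boundary_mapChains _ _ _
  have hD : boundary _ (n + 1) (contractionDiff r v w (n + 1) (cubeClass _ τ)) =
      -contractionDiff r v w n (boundary _ n (cubeClass _ τ)) := by
    rw [contractionDiff_apply, contractionDiff_apply, hcomm, map_sub, boundary_contraction,
      boundary_contraction, hcomm, hcomm, rerootChains_self hτ]
    simp only [map_sub, hw]
    abel
  rw [edgeHomotopy_apply, edgeHomotopy_apply, hr, projChains, boundary_mapChains,
    boundary_contraction, hD, map_neg, sub_neg_eq_add, map_add]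
  refine (add_comm _ _).trans ?_
  congr 1
  change projChains G (n + 2) _ = _
  rw [contractionDiff_apply, projChains_rerootChains, rerootChains_self hτ, map_sub]

end EdgeHomotopy

section Homotopy

variable {V : Type u} {G : SimpleGraph V}

theorem neg_one_pow_succAbove_add_predAbove {n : ℕ} (j : Fin (n + 2)) (i : Fin (n + 1)) :
    (-1 : ℤ) ^ ((j.succAbove i : ℕ) + 1) * (-1) ^ ((i.predAbove j : ℕ) + 1) =
      -((-1) ^ ((j : ℕ) + 1) * (-1) ^ ((i : ℕ) + 1)) := by
  rcases lt_or_ge i.castSucc j with h | h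
  · rw [Fin.succAbove_of_castSucc_lt _ _ h, Fin.predAbove_of_castSucc_lt _ _ h]
    obtain ⟨k, rfl⟩ := Fin.exists_succ_eq.2 (Fin.ne_zero_of_lt h)
    simp only [Fin.val_castSucc, Fin.pred_succ, Fin.val_succ]
    ring
  · rw [Fin.succAbove_of_le_castSucc _ _ h, Fin.predAbove_of_le_castSucc _ _ h]
    simp only [Fin.coe_castPred, Fin.val_succ]
    ring

/-- An alternating sum over ordered pairs of distinct directions of a symmetric function
vanishes. -/
theorem alternating_sum_eq_zero {M : Type*} [AddCommGroup M] {n : ℕ}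
    (F : Fin (n + 2) → Fin (n + 1) → M)
    (hF : ∀ j i, F (j.succAbove i) (i.predAbove j) = F j i) :
    ∑ j : Fin (n + 2), (-1 : ℤ) ^ ((j : ℕ) + 1) •
      ∑ i : Fin (n + 1), (-1 : ℤ) ^ ((i : ℕ) + 1) • F j i = 0 := by
  simp only [Finset.smul_sum, smul_smul]
  rw [← Fintype.sum_prod_type']
  refine Finset.sum_involution
    (fun (p : Fin (n + 2) × Fin (n + 1)) _ => (p.1.succAbove p.2, p.2.predAbove p.1)) ?_ ?_ ?_ ?_
  · rintro ⟨j, i⟩ -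
    simp only
    rw [hF, neg_one_pow_succAbove_add_predAbove, neg_smul, add_neg_cancel]
  · rintro ⟨j, i⟩ - - h
    exact Fin.succAbove_ne j i (congrArg Prod.fst h)
  · intros
    exact Finset.mem_univ _
  · rintro ⟨j, i⟩ -
    exact Prod.ext (Fin.succAbove_succAbove_predAbove j i) (Fin.predAbove_predAbove_succAbove j i)

theorem SingularCube.face_face_swap {n : ℕ} (σ : SingularCube G (n + 2)) (j : Fin (n + 2))
    (i : Fin (n + 1)) (b c : Bool) :
    (σ.face (j.succAbove i) c).face (i.predAbove j) b = (σ.face j b).face i c := by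
  rcases lt_or_ge i.castSucc j with h | h
  · obtain ⟨k, rfl⟩ := Fin.exists_succ_eq.2 (Fin.ne_zero_of_lt h)
    rw [Fin.succAbove_of_castSucc_lt _ _ h, Fin.predAbove_of_castSucc_lt _ _ h, Fin.pred_succ]
    exact (σ.face_face i k (Fin.le_def.2 (Nat.lt_succ_iff.1 (Fin.lt_def.1 h))) c b).symm
  · rw [Fin.succAbove_of_le_castSucc _ _ h, Fin.predAbove_of_le_castSucc _ _ h]
    obtain ⟨k, rfl⟩ := Fin.exists_castSucc_eq.2 (h.trans_lt (Fin.castSucc_lt_last i)).ne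
    rw [Fin.castPred_castSucc]
    exact σ.face_face k i (by simpa using h) b c

/-- The value of the contracting homotopy on a singular cube `σ` with lift `τ`. -/
noncomputable def liftHomotopy {n : ℕ} (σ : SingularCube G (n + 1))
    (τ : SingularCube (walkForest G) (n + 1)) : Chains G (n + 2) :=
  projChains G (n + 2) (contraction G (n + 1) (cubeClass _ τ)) -
    ∑ i : Fin (n + 1), (-1 : ℤ) ^ ((i : ℕ) + 1) •
      edgeHomotopy σ.base (σ.face i true).base n (cubeClass _ (τ.face i true))

theorem liftHomotopy_eq_zero {n : ℕ} {σ : SingularCube G (n + 1)}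
    {τ : SingularCube (walkForest G) (n + 1)} (h : IsLift σ τ) (hσ : σ.IsDegenerate) :
    liftHomotopy σ τ = 0 := by
  obtain ⟨j, hj⟩ := hσ
  have hτ := h.isDegenerate hj
  rw [liftHomotopy, cubeClass_eq_zero ⟨j, hτ⟩, map_zero, map_zero, zero_sub, neg_eq_zero]
  refine Finset.sum_eq_zero fun i _ => ?_
  by_cases hij : i = j
  · subst hij
    rw [← (σ.face_eq_face_iff i).2 hj, SingularCube.base_face_false, edgeHomotopy_self, smul_zero]
  · obtain ⟨k, rfl⟩ := Fin.exists_succAbove_eq (Ne.symm hij)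
    have hd : (τ.face i true).IsDegenerate :=
      ⟨k, fun x => by simpa only [SingularCube.face, Fin.insertNth_update] using hτ _⟩
    rw [cubeClass_eq_zero hd, map_zero, smul_zero]

open Classical in
/-- The homotopy which contracts the chains of degree at most one above dimension one. -/
noncomputable def degreeOneHomotopy (G : SimpleGraph V) (n : ℕ) :
    Chains G (n + 1) →ₗ[ℤ] Chains G (n + 2) :=
  Chains.lift (fun σ => if h : ∃ τ, IsLift σ τ then liftHomotopy σ h.choose else 0) fun σ hσ => by
    split_ifs with h
    · exact liftHomotopy_eq_zero h.choose_spec hσ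
    · rfl

theorem degreeOneHomotopy_cubeClass {n : ℕ} {σ : SingularCube G (n + 1)}
    {τ : SingularCube (walkForest G) (n + 1)} (h : IsLift σ τ) :
    degreeOneHomotopy G n (cubeClass G σ) = liftHomotopy σ τ := by
  have h' : ∃ τ, IsLift σ τ := ⟨τ, h⟩
  rw [degreeOneHomotopy, Chains.lift_cubeClass, dif_pos h', h'.choose_spec.unique h]

theorem boundary_liftHomotopy {n : ℕ} {σ : SingularCube G (n + 2)}
    {τ : SingularCube (walkForest G) (n + 2)} (h : IsLift σ τ) :
    boundary G (n + 2) (liftHomotopy σ τ) = cubeClass G σ -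
      ∑ j : Fin (n + 2), (-1 : ℤ) ^ ((j : ℕ) + 1) •
        ((projChains G (n + 2) (contraction G (n + 1) (cubeClass _ (τ.face j false))) -
          projChains G (n + 2) (contraction G (n + 1)
            (rerootChains (σ.face j true).base (n + 1) (cubeClass _ (τ.face j true))))) +
        ∑ i : Fin (n + 1), (-1 : ℤ) ^ ((i : ℕ) + 1) •
          (edgeHomotopy σ.base (σ.face j true).base n (cubeClass _ ((τ.face j true).face i false)) -
          edgeHomotopy σ.base (σ.face j true).base n
            (cubeClass _ ((τ.face j true).face i true)))) := by
  have hroot (j : Fin (n + 2)) (x) : ((τ.face j true).toFun x).root = σ.base := h.root_eq _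
  have hτ : projChains G (n + 2) (cubeClass _ τ) = cubeClass G σ := by
    rw [projChains, mapChains_cubeClass, h.map_proj]
  have h1 : boundary G (n + 2) (projChains G (n + 3) (contraction G (n + 2) (cubeClass _ τ))) =
      cubeClass G σ - ∑ j : Fin (n + 2), (-1 : ℤ) ^ ((j : ℕ) + 1) •
        (projChains G (n + 2) (contraction G (n + 1) (cubeClass _ (τ.face j false))) -
        projChains G (n + 2) (contraction G (n + 1) (cubeClass _ (τ.face j true)))) := by
    rw [projChains, boundary_mapChains, boundary_contraction, map_sub, boundary_cubeClass]
    simp only [map_sum, map_smul, map_sub]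
    rw [← hτ]
    rfl
  rw [liftHomotopy, map_sub, h1, map_sum, sub_sub, ← Finset.sum_add_distrib]
  refine congrArg _ (Finset.sum_congr rfl fun j _ => ?_)
  rw [map_smul, ← smul_add, boundary_edgeHomotopy (hroot j) (σ.near_base_face j),
    boundary_cubeClass]
  simp only [map_sum, map_smul, map_sub]
  congr 1
  abel

theorem boundary_degreeOneHomotopy_cubeClass (hG : G.CliqueFree 3) {n : ℕ}
    {σ : SingularCube G (n + 2)} (hσ : σ.degree ≤ 1) :
    boundary G (n + 2) (degreeOneHomotopy G (n + 1) (cubeClass G σ)) +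
      degreeOneHomotopy G n (boundary G (n + 1) (cubeClass G σ)) = cubeClass G σ := by
  obtain ⟨τ, hτ1, hτ2⟩ := exists_lift hG σ hσ (ReducedWalk.nil σ.base) rfl
  have h : IsLift σ τ := ⟨hτ1, hτ2⟩
  rw [degreeOneHomotopy_cubeClass h, boundary_liftHomotopy h, boundary_cubeClass]
  simp only [map_sum, map_smul, map_sub, degreeOneHomotopy_cubeClass (h.face_false _),
    degreeOneHomotopy_cubeClass (h.face_true _)]
  rw [sub_add_eq_add_sub, sub_eq_iff_eq_add]
  refine congrArg _ ?_
  rw [← sub_eq_zero, ← Finset.sum_sub_distrib]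
  have hface (j : Fin (n + 2)) (i : Fin (n + 1)) (c : Bool) (w : V) :
      cubeClass _ (((τ.face j c).map (ReducedWalk.rerootMap w)).face i true) =
        rerootChains w n (cubeClass _ ((τ.face j c).face i true)) := by
    rw [rerootChains_cubeClass]
    rfl
  refine Eq.trans (Finset.sum_congr rfl fun j _ => ?_) (alternating_sum_eq_zero (fun j i =>
    edgeHomotopy (σ.face j true).base ((σ.face j true).face i true).base n
        (rerootChains (σ.face j true).base n (cubeClass _ ((τ.face j true).face i true))) +
      edgeHomotopy σ.base (σ.face j true).base n (cubeClass _ ((τ.face j true).face i true)) -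
      (edgeHomotopy σ.base ((σ.face j false).face i true).base n
        (cubeClass _ ((τ.face j false).face i true)) +
      edgeHomotopy σ.base (σ.face j true).base n
        (cubeClass _ ((τ.face j true).face i false)))) fun j i => ?_)
  · rw [← smul_sub]
    congr 1
    simp only [liftHomotopy, hface, SingularCube.base_face_false, rerootChains_cubeClass,
      smul_sub, smul_add, Finset.sum_sub_distrib, Finset.sum_add_distrib]
    abel
  · have hb : ((σ.face (j.succAbove i) false).face (i.predAbove j) true).base =
        (σ.face j true).base := by
      rw [SingularCube.face_face_swap, SingularCube.base_face_false]
    have hb' : ((σ.face j false).face i true).base = (σ.face (j.succAbove i) true).base := by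
      rw [← SingularCube.face_face_swap, SingularCube.base_face_false]
    have hroot (x) : (((τ.face j true).face i true).toFun x).root = σ.base := h.root_eq _
    have hthin : ReducedWalk.IsThin σ.base (σ.face j true).base
        ((σ.face j true).face i true).base (σ.face (j.succAbove i) true).base := by
      have := SingularCube.isThin_square hG hσ (fun _ => false) (Fin.succAbove_ne j i).symm
        false false true true
      simp only [← SingularCube.base_face_face] at this
      rwa [SingularCube.base_face_false, SingularCube.base_face_false,
        SingularCube.base_face_false, hb'] at this
    have hsq := edgeHomotopy_square hroot (σ.near_base_face j)
      (σ.near_base_face (j.succAbove i)) hthin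
    rw [hb, hb']
    simp only [SingularCube.face_face_swap]
    rw [add_comm (edgeHomotopy _ _ n (rerootChains _ n _)),
      add_comm (edgeHomotopy _ _ n (rerootChains _ n _)), ← hsq]
    congr 1
    exact add_comm _ _

theorem projChains_mem_degreeFiltration {n : ℕ} (c : Chains (walkForest G) n) :
    projChains G n c ∈ degreeFiltration G 1 n := by
  obtain ⟨c, rfl⟩ := Submodule.mkQ_surjective _ c
  induction c using Finsupp.induction_linear with
  | zero => simp
  | add a b ha hb => rw [map_add, map_add]; exact Submodule.add_mem _ ha hb
  | single τ a =>
    have : Finsupp.single τ a = a • Finsupp.single τ (1 : ℤ) := by simp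
    rw [this, map_smul, map_smul]
    refine Submodule.smul_mem _ _ (Submodule.subset_span ⟨τ.map (ReducedWalk.proj G), ?_, ?_⟩)
    · have hdeg : (τ.map (ReducedWalk.proj G)).degree ≤ 1 := by
        rw [SingularCube.degree_le_iff]
        intro S a hS
        refine (τ.degree_le_iff 1).1 (degree_le_one τ) S a fun x hx y hy hxy => hS hx hy ?_
        exact congrArg (ReducedWalk.proj G).toFun hxy
      exact_mod_cast hdeg
    · exact mapChains_cubeClass _ τ

theorem degreeOneHomotopy_mem (n : ℕ) (c : Chains G (n + 1)) :
    degreeOneHomotopy G n c ∈ degreeFiltration G 1 (n + 2) := by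
  obtain ⟨c, rfl⟩ := Submodule.mkQ_surjective _ c
  induction c using Finsupp.induction_linear with
  | zero => simp
  | add a b ha hb => rw [map_add, map_add]; exact Submodule.add_mem _ ha hb
  | single σ a =>
    have : Finsupp.single σ a = a • Finsupp.single σ (1 : ℤ) := by simp
    rw [this, map_smul, map_smul]
    refine Submodule.smul_mem _ _ ?_
    change degreeOneHomotopy G n (cubeClass G σ) ∈ _
    by_cases h : ∃ τ, IsLift σ τ
    · obtain ⟨τ, h⟩ := h
      rw [degreeOneHomotopy_cubeClass h]
      exact Submodule.sub_mem _ (projChains_mem_degreeFiltration _)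
        (Submodule.sum_mem _ fun i _ => Submodule.smul_mem _ _ (projChains_mem_degreeFiltration _))
    · rw [degreeOneHomotopy, Chains.lift_cubeClass, dif_neg h]
      exact Submodule.zero_mem _

theorem boundary_degreeOneHomotopy (hG : G.CliqueFree 3) {n : ℕ} {c : Chains G (n + 2)}
    (hc : c ∈ degreeFiltration G 1 (n + 2)) :
    boundary G (n + 2) (degreeOneHomotopy G (n + 1) c) +
      degreeOneHomotopy G n (boundary G (n + 1) c) = c := by
  suffices hle : degreeFiltration G 1 (n + 2) ≤ LinearMap.eqLocus
      (boundary G (n + 2) ∘ₗ degreeOneHomotopy G (n + 1) +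
        degreeOneHomotopy G n ∘ₗ boundary G (n + 1)) LinearMap.id from hle hc
  rw [degreeFiltration, Submodule.span_le]
  rintro _ ⟨σ, hσ, rfl⟩
  exact boundary_degreeOneHomotopy_cubeClass hG (by exact_mod_cast hσ)

theorem degreeFiltration_zero_succ (n : ℕ) : degreeFiltration G 0 (n + 1) = ⊥ := by
  rw [degreeFiltration, eq_bot_iff, Submodule.span_le]
  rintro _ ⟨σ, hσ, rfl⟩
  refine cubeClass_eq_zero ⟨0, fun x => ?_⟩
  by_contra hne
  have hinj : Set.InjOn σ.toFun (cubeFace {0} x) := by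
    have hrep : ∀ y ∈ cubeFace {0} x, y = Function.update x 0 (y 0) := by
      intro y hy
      funext k
      by_cases hk : k = 0
      · subst hk; simp
      · rw [Function.update_of_ne hk]
        exact hy k (by simpa using hk)
    intro y hy z hz hyz
    rw [hrep y hy, hrep z hz] at hyz ⊢
    cases hy0 : y 0 <;> cases hz0 : z 0 <;> rw [hy0, hz0] at hyz
    · exact absurd hyz hne
    · exact absurd hyz.symm hne
  have := (σ.degree_le_iff 0).1 (by exact_mod_cast hσ) {0} x hinj
  simp at this

theorem gradedComplex_d (G : SimpleGraph V) (k : ℤ) (n : ℕ) :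
    (gradedComplex G k).d (n + 1) n = ModuleCat.ofHom (gradedBoundary G k n) :=
  ChainComplex.of_d (fun n => ModuleCat.of ℤ (GradedChains G k n))
    (fun n => ModuleCat.ofHom (gradedBoundary G k n)) n

theorem gradedBoundary_exact (hG : G.CliqueFree 3) (n : ℕ) (x : GradedChains G 1 (n + 2))
    (hx : gradedBoundary G 1 (n + 1) x = 0) : ∃ y, gradedBoundary G 1 (n + 2) y = x := by
  obtain ⟨c, rfl⟩ := Submodule.mkQ_surjective _ x
  have h0 : boundary G (n + 1) c.1 = 0 := by
    have h1 : filteredBoundary G 1 (n + 1) c ∈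
        (degreeFiltration G (1 - 1) (n + 1)).submoduleOf (degreeFiltration G 1 (n + 1)) :=
      (Submodule.Quotient.mk_eq_zero _).1 hx
    have h2 : boundary G (n + 1) c.1 ∈ degreeFiltration G (1 - 1) (n + 1) := h1
    rwa [sub_self, degreeFiltration_zero_succ, Submodule.mem_bot] at h2
  refine ⟨Submodule.mkQ _ ⟨degreeOneHomotopy G (n + 1) c.1, degreeOneHomotopy_mem _ _⟩, ?_⟩
  change Submodule.mkQ _ (filteredBoundary G 1 (n + 2) _) = _
  congr 1
  refine Subtype.ext ?_
  have := boundary_degreeOneHomotopy hG c.2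
  rw [h0, map_zero, add_zero] at this
  exact this

end Homotopy

end DiscreteCubical

theorem mainTheorem2 {V : Type u} (G : SimpleGraph V) (hG : G.CliqueFree 3) (n : ℕ) (hn : 2 ≤ n) :
    Limits.IsZero (DiscreteCubical.gradedHomology G 1 n) := by
  obtain ⟨m, rfl⟩ := Nat.exists_eq_add_of_le' hn
  rw [DiscreteCubical.gradedHomology, ← HomologicalComplex.exactAt_iff_isZero_homology,
    HomologicalComplex.exactAt_iff' _ (m + 3) (m + 2) (m + 1) (by simp) (by simp),
    ShortComplex.moduleCat_exact_iff]
  intro x hx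
  change (DiscreteCubical.gradedComplex G 1).d (m + 1 + 1) (m + 1) x = 0 at hx
  rw [DiscreteCubical.gradedComplex_d] at hx
  obtain ⟨y, hy⟩ := DiscreteCubical.gradedBoundary_exact hG m x hx
  refine ⟨y, ?_⟩
  change (DiscreteCubical.gradedComplex G 1).d (m + 2 + 1) (m + 2) y = x
  rw [DiscreteCubical.gradedComplex_d]
  exact hy
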